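/- Let $(M,g)$ be a smooth Riemannian manifold of finite dimension $n$ with Levi-Civita connection $\nabla$, curvature tensor $R(X,Y)Z=\nabla_X\nabla_YZ-\nabla_Y\nabla_XZ-\nabla_{[X,Y]}Z$ and sectional curvature $K$. Let $\mathcal D$ be the unit circle $S^1$ or the unit interval $[0,1]$, and let $C$ be a smooth path $s\mapsto c(s,\cdot)$, $s\in[0,1]$, of smooth immersed curves $\mathcal D\to M$. Write $c'=\partial_s c$ and $\dot c=\partial_t c$, let a prime denote $\partial_s$, and put $\omega=|\dot c|$, $T=\dot c/\omega$, $\nabla_T=\omega^{-1}\nabla_{\dot c}$, $f_\theta=\omega^{-1}\partial_tf$, $d\theta=\omega\,dt$. Where the curvature is concerned, let $N$ be a smooth unit vector field along $c$ with $g(N,T)=0$ and $\nabla_TT=\kappa N$, where the function $\kappa$ is the (signed) curvature. The first order Sobolev metric is $$G_c(h,k)=\int_{\mathcal D} g(h,k)+g(\nabla_Th,\nabla_Tk)\,d\theta ,$$ and $C$ is called horizontal if, for every $s$, $G_{c(s,\cdot)}(c',a\dot c)=0$ for all $a\in C^\infty(\mathcal D,\mathbb R)$, with $a(0)=a(1)=0$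 if $\mathcal D=[0,1]$. (a) We have $\omega'=g(\nabla_Tc',T)\,\omega$ and $$\kappa'=g(\nabla_T^2c',N)-2\kappa\,g(\nabla_Tc',T)+g(R(c',T)T,N).$$ At every point where $n=2$, or $c'$ lies in the span of $T$ and $N$, or all tangent planes of $M$ have the same sectional curvature, this reads $$\kappa'=g(\nabla_T^2c',N)-2\kappa\,g(\nabla_Tc',T)+K(N,T)\,g(c',N).$$ (b) Suppose that $C$ is normal in the sense that $c'=\rho N$ with $\rho=g(c',N)$. Then $\omega'=-\rho\kappa\omega$. Moreover, $C$ is horizontal if and only if $(\rho^2\kappa)_\theta=0$, i.e. if and only if $\rho^2\kappa$ is constant along each of the curves $t\mapsto c(s,t)$. -/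

import Mathlib

open Set Bundle Manifold
open scoped ContDiff

noncomputable section

namespace CurveVariation

/-! ### The Levi-Civita connection and the curvature, in charts -/

section Riemannian

variable {n : ℕ} {M : Type*} [TopologicalSpace M] [ChartedSpace (EuclideanSpace ℝ (Fin n)) M]
  [IsManifold (𝓡 n) ∞ M] [RiemannianBundle (fun x : M => TangentSpace (𝓡 n) x)]

/-- The `k`-th standard basis vector of `ℝⁿ`. -/
def stdVec (n : ℕ) (k : Fin n) : EuclideanSpace ℝ (Fin n) := EuclideanSpace.single k 1

/-- The Riemannian metric in the preferred chart at `p`: at the point of `M` with coordinates `y`,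
the inner product of the tangent vectors with components `u` and `v`. -/
def metricInChart (p : M) (y u v : EuclideanSpace ℝ (Fin n)) : ℝ :=
  let x : M := (extChartAt (𝓡 n) p).symm y
  let e := trivializationAt (EuclideanSpace ℝ (Fin n)) (TangentSpace (𝓡 n) : M → Type _) p
  inner ℝ (e.symmL ℝ x u) (e.symmL ℝ x v)

/-- The inverse `g^{kl}` of the Gram matrix `g_{kl}` in the preferred chart at `p`. -/
def inverseMetric (p : M) (y : EuclideanSpace ℝ (Fin n)) : Matrix (Fin n) (Fin n) ℝ :=
  (Matrix.of fun k l => metricInChart p y (stdVec n k) (stdVec n l))⁻¹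

/-- The Christoffel symbols of the Levi-Civita connection in the preferred chart at `p`, as a
bilinear map: `Γ(u, v)^k = ½ g^{kl} (∂_u g(v, e_l) + ∂_v g(u, e_l) - ∂_l g(u, v))`. -/
def christoffel (p : M) (y u v : EuclideanSpace ℝ (Fin n)) : EuclideanSpace ℝ (Fin n) :=
  ∑ k, (∑ l, inverseMetric p y k l * ((1 / 2 : ℝ) *
    (fderiv ℝ (fun z => metricInChart p z v (stdVec n l)) y u
      + fderiv ℝ (fun z => metricInChart p z u (stdVec n l)) y v
      - fderiv ℝ (fun z => metricInChart p z u v) y (stdVec n l)))) • stdVec n k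

/-- The curvature tensor `R(u, v) w = ∇_u ∇_v w - ∇_v ∇_u w - ∇_[u,v] w` at `p`, computed in the
preferred chart at `p` (in which `T_p M` is identified with `ℝⁿ`):
`R(u, v) w = ∂_u Γ(v, w) - ∂_v Γ(u, w) + Γ(u, Γ(v, w)) - Γ(v, Γ(u, w))`. -/
def riemannCurvature (p : M) (u v w : TangentSpace (𝓡 n) p) : TangentSpace (𝓡 n) p :=
  let y : EuclideanSpace ℝ (Fin n) := extChartAt (𝓡 n) p p
  let Γ : EuclideanSpace ℝ (Fin n) → EuclideanSpace ℝ (Fin n) → EuclideanSpace ℝ (Fin n) →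
    EuclideanSpace ℝ (Fin n) := fun z a b => christoffel p z a b
  ((fderiv ℝ (fun z => Γ z v w) y u - fderiv ℝ (fun z => Γ z u w) y v
    + Γ y u (Γ y v w) - Γ y v (Γ y u w) : EuclideanSpace ℝ (Fin n)))

/-- The sectional curvature of the plane spanned by `u` and `v`. -/
def sectionalCurvature (p : M) (u v : TangentSpace (𝓡 n) p) : ℝ :=
  inner ℝ (riemannCurvature p u v v) u / (inner ℝ u u * inner ℝ v v - inner ℝ u v ^ 2)

/-! ### Vector fields along curves

A curve is a map `γ : ℝ → M` that matters only on the parameter set `S ⊆ ℝ`; at the endpoints of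
`S` derivatives are one-sided. -/

/-- The velocity of `γ`. -/
def velocity (S : Set ℝ) (γ : ℝ → M) (t : ℝ) : TangentSpace (𝓡 n) (γ t) :=
  mfderivWithin 𝓘(ℝ, ℝ) (𝓡 n) γ S t (1 : ℝ)

/-- The Levi-Civita covariant derivative along `γ` of a vector field `V` along `γ`. At the parameter
`t` it is `dV^k/dt + Γ^k_{ij} (dγ^i/dt) V^j` in the preferred chart at `γ t`. -/
def covDeriv (S : Set ℝ) (γ : ℝ → M) (V : ∀ t, TangentSpace (𝓡 n) (γ t)) (t : ℝ) :
    TangentSpace (𝓡 n) (γ t) :=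
  let e := trivializationAt (EuclideanSpace ℝ (Fin n)) (TangentSpace (𝓡 n) : M → Type _) (γ t)
  (derivWithin (fun τ => (e (TotalSpace.mk' (EuclideanSpace ℝ (Fin n)) (γ τ) (V τ))).2) S t
    + christoffel (γ t) (extChartAt (𝓡 n) (γ t) (γ t)) (velocity S γ t) (V t) :
    EuclideanSpace ℝ (Fin n))

/-- The line element `ω = |dγ/dt|`. -/
def lineElement (S : Set ℝ) (γ : ℝ → M) (t : ℝ) : ℝ :=
  Real.sqrt (inner ℝ (velocity (n := n) S γ t) (velocity S γ t))

/-- The unit tangent field `T = ω⁻¹ dγ/dt`. -/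
def unitTangent (S : Set ℝ) (γ : ℝ → M) (t : ℝ) : TangentSpace (𝓡 n) (γ t) :=
  (lineElement (n := n) S γ t)⁻¹ • velocity S γ t

/-- The covariant derivative `∇_T V = ω⁻¹ ∇_{dγ/dt} V` with respect to arc length. -/
def covDerivT (S : Set ℝ) (γ : ℝ → M) (V : ∀ t, TangentSpace (𝓡 n) (γ t)) (t : ℝ) :
    TangentSpace (𝓡 n) (γ t) :=
  (lineElement (n := n) S γ t)⁻¹ • covDeriv S γ V t

/-- The derivative `f_θ = ω⁻¹ df/dt` of a function along `γ` with respect to arc length. -/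
def derivTheta (n : ℕ) {M : Type*} [TopologicalSpace M]
    [ChartedSpace (EuclideanSpace ℝ (Fin n)) M] [IsManifold (𝓡 n) ∞ M]
    [RiemannianBundle (fun x : M => TangentSpace (𝓡 n) x)]
    (S : Set ℝ) (γ : ℝ → M) (f : ℝ → ℝ) (t : ℝ) : ℝ :=
  (lineElement (n := n) S γ t)⁻¹ * derivWithin f S t

end Riemannian

/-! ### The space of immersed curves -/

/-- The domain of the curves: the unit circle (closed curves) or the unit interval (open curves). -/
inductive CurveDomain
  | circle
  | interval

/-- The length of the parameter interval. -/
def CurveDomain.period : CurveDomain → ℝ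
  | circle => 2 * Real.pi
  | interval => 1

/-- The parameter set. Functions on the unit circle are `2π`-periodic functions on `ℝ`. -/
def CurveDomain.carrier : CurveDomain → Set ℝ
  | circle => univ
  | interval => Icc 0 1

/-- The functions `a` that generate the vertical fields `a dγ/dt`: the smooth functions on the unit
circle, or those on the unit interval that vanish at both endpoints. -/
def IsVerticalCoefficient (D : CurveDomain) (a : ℝ → ℝ) : Prop :=
  ContDiffOn ℝ ∞ a D.carrier ∧
    match D with
    | .circle => ∀ t, a (t + 2 * Real.pi) = a t
    | .interval => a 0 = 0 ∧ a 1 = 0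

section Space

variable {n : ℕ} {M : Type*} [TopologicalSpace M] [ChartedSpace (EuclideanSpace ℝ (Fin n)) M]
  [IsManifold (𝓡 n) ∞ M] [RiemannianBundle (fun x : M => TangentSpace (𝓡 n) x)]

/-- The first order Sobolev metric `∫ g(h, k) + g(∇_T h, ∇_T k) dθ`, `dθ = ω dt`. -/
def sobolevMetric (D : CurveDomain) (γ : ℝ → M) (h k : ∀ t, TangentSpace (𝓡 n) (γ t)) : ℝ :=
  ∫ t in (0 : ℝ)..D.period,
    (inner ℝ (h t) (k t)
      + inner ℝ (covDerivT D.carrier γ h t) (covDerivT D.carrier γ k t))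
      * lineElement (n := n) D.carrier γ t

/-- A vector field along `γ` is horizontal if it is orthogonal, with respect to the Sobolev metric,
to every vertical field `a dγ/dt`. -/
def IsHorizontal (D : CurveDomain) (γ : ℝ → M) (h : ∀ t, TangentSpace (𝓡 n) (γ t)) : Prop :=
  ∀ a : ℝ → ℝ, IsVerticalCoefficient D a →
    sobolevMetric D γ h (fun t => a t • velocity D.carrier γ t) = 0

/-- The tangent field `c'` (derivative with respect to the path parameter `s ∈ [0, 1]`). -/
def pathDeriv (c : ℝ → ℝ → M) (s t : ℝ) : TangentSpace (𝓡 n) (c s t) :=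
  velocity (Icc 0 1) (fun σ => c σ t) s

/-- `c` is a smooth path, with parameter `s ∈ [0, 1]`, of smooth immersed curves `c s`. -/
structure IsCurvePath (n : ℕ) {M : Type*} [TopologicalSpace M]
    [ChartedSpace (EuclideanSpace ℝ (Fin n)) M] [IsManifold (𝓡 n) ∞ M]
    (D : CurveDomain) (c : ℝ → ℝ → M) : Prop where
  smooth : ContMDiffOn 𝓘(ℝ, ℝ × ℝ) (𝓡 n) ∞ (fun q : ℝ × ℝ => c q.1 q.2) (Icc 0 1 ×ˢ D.carrier)
  periodic : D = .circle → ∀ s ∈ Icc (0 : ℝ) 1, ∀ t, c s (t + 2 * Real.pi) = c s t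
  immersed : ∀ s ∈ Icc (0 : ℝ) 1, ∀ t ∈ D.carrier, velocity (n := n) D.carrier (c s) t ≠ 0

/-- A path of curves is horizontal if its tangent field is horizontal at every parameter. -/
def IsHorizontalPath (n : ℕ) {M : Type*} [TopologicalSpace M]
    [ChartedSpace (EuclideanSpace ℝ (Fin n)) M] [IsManifold (𝓡 n) ∞ M]
    [RiemannianBundle (fun x : M => TangentSpace (𝓡 n) x)]
    (D : CurveDomain) (c : ℝ → ℝ → M) : Prop :=
  ∀ s ∈ Icc (0 : ℝ) 1, IsHorizontal (n := n) D (c s) (fun t => pathDeriv c s t)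

/-- `N` is a smooth unit normal field along the curves of the path, and `κ` the signed curvature
with respect to it: `∇_T T = κ N`. -/
structure IsNormalWithCurvature (D : CurveDomain) (c : ℝ → ℝ → M)
    (N : ∀ s t, TangentSpace (𝓡 n) (c s t)) (κ : ℝ → ℝ → ℝ) : Prop where
  smooth : ContMDiffOn 𝓘(ℝ, ℝ × ℝ) (𝓡 n).tangent ∞
    (fun q : ℝ × ℝ => (⟨c q.1 q.2, N q.1 q.2⟩ : TangentBundle (𝓡 n) M)) (Icc 0 1 ×ˢ D.carrier)
  unit : ∀ s ∈ Icc (0 : ℝ) 1, ∀ t ∈ D.carrier, inner ℝ (N s t) (N s t) = (1 : ℝ)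
  normal : ∀ s ∈ Icc (0 : ℝ) 1, ∀ t ∈ D.carrier,
    inner ℝ (N s t) (unitTangent D.carrier (c s) t) = (0 : ℝ)
  curvature : ∀ s ∈ Icc (0 : ℝ) 1, ∀ t ∈ D.carrier,
    covDerivT D.carrier (c s) (unitTangent D.carrier (c s)) t = κ s t • N s t

/-- All planes in the tangent space at `p` have the same sectional curvature. -/
def HasIsotropicCurvatureAt (n : ℕ) {M : Type*} [TopologicalSpace M]
    [ChartedSpace (EuclideanSpace ℝ (Fin n)) M] [IsManifold (𝓡 n) ∞ M]
    [RiemannianBundle (fun x : M => TangentSpace (𝓡 n) x)] (p : M) : Prop :=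
  ∃ k : ℝ, ∀ u v : TangentSpace (𝓡 n) p, LinearIndependent ℝ ![u, v] → sectionalCurvature p u v = k

end Space

end CurveVariation

end

open CurveVariation

open Set Bundle Manifold
open scoped ContDiff

noncomputable section

/-! Everything rests on three properties of the covariant derivative along the parameter surface
$(s,t)\mapsto c(s,t)$: it is metric (`hasDerivWithinAt_inner`), it is torsion free, $\nabla_s\dot
c=\nabla_t c'$ (`covFst_velocity_snd`), and its commutator is the curvature,
$\nabla_s\nabla_tV=\nabla_t\nabla_sV+R(c',\dot c)V$ (`covFst_covSnd`). The derivative at each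
parameter is computed in a chart that moves with the base point, so these properties are available
only after showing that the formula is valid in every chart. That is the transformation law of the
Christoffel symbols, which follows from the Koszul formula because transition maps are isometries of
the coordinate metrics (`IsKoszul.transform`, `chartVec_covDeriv`).

Put $\alpha=g(\nabla_Tc',T)$. Differentiating $\omega^2=g(\dot c,\dot c)$ gives
$\omega'=\alpha\omega$, hence $\nabla_sT=\nabla_Tc'-\alpha T$ and
$\nabla_s\nabla_TT=-\alpha\nabla_TT+\nabla_T(\nabla_Tc'-\alpha T)+R(c',T)T$. Pairing with $N$
removes the multiple of $T$, and $\nabla_sN\perp N$ removes the contribution of $\nabla_sN$, which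
leaves the formula for $\kappa'$ (`hasDerivWithinAt_curvature`). The curvature term becomes
$K(N,T)\,g(c',N)$ by linearity if $c'$ lies in the span of $T$ and $N$, and by polarising the Jacobi
form $v\mapsto g(R(v,T)T,v)$ if all planes have the same curvature.

For $c'=\rho N$, differentiating $g(c',T)=0$ along the curve gives $\alpha=-\rho\kappa$. With
$b=a\omega$ one has $\nabla_T(a\dot c)=b_\theta T+b\kappa N$, so the integrand of $G_c(c',a\dot c)$
is $b\,q-(b\rho\kappa)_t$ with $q=\kappa\rho_t+(\rho\kappa)_t$ (`sobolev_integrand_eq`). The total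
derivative integrates to zero, by periodicity or because $a$ vanishes at the endpoints.
Horizontality therefore means $q=0$, by the fundamental lemma of the calculus of variations. Finally
$(\rho^2\kappa)_t=\rho q$, and $\rho q=0$ everywhere forces $q=0$, since $q$ also vanishes wherever
$\rho$ vanishes on a neighbourhood (`derivWithin_sq_mul_eq_zero_iff`). -/

namespace CurveVariation

set_option linter.unusedSectionVars false
set_option synthInstance.maxHeartbeats 400000
set_option maxHeartbeats 1000000

/-! ### Levi-Civita connection and curvature of a metric on a vector space -/

section LocalMetric

variable {E : Type*} [NormedAddCommGroup E] [NormedSpace ℝ E]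

/-- The Koszul formula: `Γ` is the Levi-Civita connection of the metric field `G` at `y`. -/
def IsKoszul (G : E → E →L[ℝ] E →L[ℝ] ℝ) (y : E) (Γ : E →L[ℝ] E →L[ℝ] E) : Prop :=
  ∀ u v w, 2 * G y (Γ u v) w =
    fderiv ℝ G y u v w + fderiv ℝ G y v u w - fderiv ℝ G y w u v

/-- The curvature of the connection with Christoffel map `Γ`. -/
def localCurvature (Γ : E → E →L[ℝ] E →L[ℝ] E) (y u v w : E) : E :=
  fderiv ℝ Γ y u v w - fderiv ℝ Γ y v u w + Γ y u (Γ y v w) - Γ y v (Γ y u w)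

theorem hasFDerivAt_clm_apply_apply {F H : Type*} [NormedAddCommGroup F] [NormedSpace ℝ F]
    [NormedAddCommGroup H] [NormedSpace ℝ H]
    {A : F → E →L[ℝ] E →L[ℝ] H} {f g : F → E} {A' f' g'} {y : F}
    (hA : HasFDerivAt A A' y) (hf : HasFDerivAt f f' y) (hg : HasFDerivAt g g' y) :
    HasFDerivAt (fun z => A z (f z) (g z))
      (((A y (f y)).comp g') + (((A y).comp f' + A'.flip (f y)).flip (g y))) y :=
  (hA.clm_apply hf).clm_apply hg

theorem fderiv_clm_apply_apply_const {H : Type*} [NormedAddCommGroup H] [NormedSpace ℝ H]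
    {A : E → E →L[ℝ] E →L[ℝ] H} {y : E} (hA : DifferentiableAt ℝ A y) (u v a : E) :
    fderiv ℝ (fun z => A z u v) y a = fderiv ℝ A y a u v := by
  rw [(hasFDerivAt_clm_apply_apply hA.hasFDerivAt (hasFDerivAt_const u y)
    (hasFDerivAt_const v y)).fderiv]
  simp

variable {G : E → E →L[ℝ] E →L[ℝ] ℝ} {Ω : Set E} {y : E}

theorem fderiv_metric_symm (hG : DifferentiableAt ℝ G y)
    (hsymm : ∀ᶠ z in nhds y, ∀ u v, G z u v = G z v u) (a u v : E) :
    fderiv ℝ G y a u v = fderiv ℝ G y a v u := by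
  rw [← fderiv_clm_apply_apply_const hG, ← fderiv_clm_apply_apply_const hG]
  have : (fun z => G z u v) =ᶠ[nhds y] fun z => G z v u := hsymm.mono fun z h => h u v
  rw [this.fderiv_eq]

/-- In the sum of the Koszul formulas for $(a,b,c)$ and $(a,c,b)$ all derivatives cancel except
twice $\partial_aG(b,c)$. -/
theorem IsKoszul.compatible {Γ : E →L[ℝ] E →L[ℝ] E} (hΓ : IsKoszul G y Γ)
    (hG : DifferentiableAt ℝ G y)
    (hsymm : ∀ᶠ z in nhds y, ∀ u v, G z u v = G z v u) (a b c : E) :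
    fderiv ℝ G y a b c = G y (Γ a b) c + G y b (Γ a c) := by
  have h1 := hΓ a b c
  have h2 := hΓ a c b
  rw [hsymm.self_of_nhds] at h2
  have s := fderiv_metric_symm hG hsymm
  rw [s a c b, s c a b, s b a c] at h2
  rw [s c a b, s b a c] at h1
  linarith

theorem eq_of_metric_eq (hpos : ∀ u, G y u u = 0 → u = 0) {u v : E}
    (h : ∀ w, G y u w = G y v w) : u = v := by
  rw [← sub_eq_zero]
  apply hpos
  simp [h]

theorem IsKoszul.symm {Γ : E →L[ℝ] E →L[ℝ] E} (hΓ : IsKoszul G y Γ)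
    (hG : DifferentiableAt ℝ G y) (hsymm : ∀ᶠ z in nhds y, ∀ u v, G z u v = G z v u)
    (hpos : ∀ u, G y u u = 0 → u = 0) (u v : E) : Γ u v = Γ v u := by
  refine eq_of_metric_eq hpos fun w => ?_
  have h1 := hΓ u v w
  have h2 := hΓ v u w
  rw [fderiv_metric_symm hG hsymm w v u] at h2
  linarith

/-- The transformation law of the Christoffel symbols under the change of coordinates `φ`. -/
theorem IsKoszul.transform {G₁ G₂ : E → E →L[ℝ] E →L[ℝ] ℝ} {φ : E → E} {y : E}
    {Γ₁ Γ₂ : E →L[ℝ] E →L[ℝ] E} (h₁ : IsKoszul G₁ y Γ₁) (h₂ : IsKoszul G₂ (φ y) Γ₂)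
    (hG : DifferentiableAt ℝ G₂ (φ y)) (hG₁ : DifferentiableAt ℝ G₁ y)
    (hsymm : ∀ᶠ z in nhds (φ y), ∀ u v, G₂ z u v = G₂ z v u)
    (hpos : ∀ u, G₂ (φ y) u u = 0 → u = 0) (hφ : ContDiffAt ℝ 2 φ y)
    (hiso : ∀ᶠ z in nhds y, ∀ u v, G₁ z u v = G₂ (φ z) (fderiv ℝ φ z u) (fderiv ℝ φ z v))
    (hsurj : Function.Surjective (fderiv ℝ φ y)) (u v : E) :
    fderiv ℝ φ y (Γ₁ u v) =
      Γ₂ (fderiv ℝ φ y u) (fderiv ℝ φ y v) + fderiv ℝ (fderiv ℝ φ) y u v := by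
  have hφ1 : HasFDerivAt φ (fderiv ℝ φ y) y := (hφ.differentiableAt (by norm_num)).hasFDerivAt
  have hφ2 : HasFDerivAt (fderiv ℝ φ) (fderiv ℝ (fderiv ℝ φ) y) y :=
    ((hφ.fderiv_right (m := 1) (by norm_num)).differentiableAt (by norm_num)).hasFDerivAt
  -- Product rule for the pulled-back metric. In the Koszul combination the second derivatives of
  -- `φ`, being symmetric, cancel except for twice the pairing of $D^2\varphi(u,v)$ with
  -- $D\varphi(w)$. This is the inhomogeneous term of the law.
  have hD : ∀ a b c, fderiv ℝ G₁ y a b c =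
      fderiv ℝ G₂ (φ y) (fderiv ℝ φ y a) (fderiv ℝ φ y b) (fderiv ℝ φ y c)
      + G₂ (φ y) (fderiv ℝ (fderiv ℝ φ) y a b) (fderiv ℝ φ y c)
      + G₂ (φ y) (fderiv ℝ φ y b) (fderiv ℝ (fderiv ℝ φ) y a c) := by
    intro a b c
    rw [← fderiv_clm_apply_apply_const hG₁]
    have : (fun z => G₁ z b c) =ᶠ[nhds y]
        fun z => G₂ (φ z) (fderiv ℝ φ z b) (fderiv ℝ φ z c) := hiso.mono fun z h => h b c
    have hGφ : HasFDerivAt (fun z => G₂ (φ z)) ((fderiv ℝ G₂ (φ y)).comp (fderiv ℝ φ y)) y :=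
      HasFDerivAt.comp (𝕜 := ℝ) (E := E) (F := E) (G := E →L[ℝ] E →L[ℝ] ℝ) (g := G₂) y
        hG.hasFDerivAt hφ1
    rw [this.fderiv_eq, (hasFDerivAt_clm_apply_apply hGφ
      (hφ2.clm_apply (hasFDerivAt_const b y)) (hφ2.clm_apply (hasFDerivAt_const c y))).fderiv]
    simp
    ring
  have hsnd : ∀ a b, fderiv ℝ (fderiv ℝ φ) y a b = fderiv ℝ (fderiv ℝ φ) y b a := fun a b =>
    (hφ.isSymmSndFDerivAt (by simp)) a b
  refine eq_of_metric_eq hpos fun w => ?_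
  obtain ⟨w, rfl⟩ := hsurj w
  have k₁ := h₁ u v w
  have k₂ := h₂ (fderiv ℝ φ y u) (fderiv ℝ φ y v) (fderiv ℝ φ y w)
  rw [hiso.self_of_nhds, hD, hD, hD, hsnd w u, hsnd w v, hsnd v u] at k₁
  have s := hsymm.self_of_nhds
  rw [map_add, add_apply]
  have s1 := s (fderiv ℝ φ y v) (fderiv ℝ (fderiv ℝ φ) y u w)
  have s2 := s (fderiv ℝ φ y u) (fderiv ℝ (fderiv ℝ φ) y v w)
  linarith

section Curvature

variable {Γ : E → E →L[ℝ] E →L[ℝ] E}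

theorem localCurvature_swap (u v w : E) :
    localCurvature Γ y v u w = -localCurvature Γ y u v w := by
  simp only [localCurvature]; abel

theorem localCurvature_add_left (u u' v w : E) : localCurvature Γ y (u + u') v w =
    localCurvature Γ y u v w + localCurvature Γ y u' v w := by
  simp only [localCurvature, ContinuousLinearMap.map_add, add_apply]
  abel

theorem localCurvature_smul_left (a : ℝ) (u v w : E) :
    localCurvature Γ y (a • u) v w = a • localCurvature Γ y u v w := by
  simp only [localCurvature, ContinuousLinearMap.map_smul, smul_apply, smul_sub, smul_add]

/-- For a symmetric `Γ` the derivative terms and the quadratic terms of the cyclic sum cancel in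
pairs. -/
theorem localCurvature_bianchi (hΓ : DifferentiableAt ℝ Γ y)
    (hs : ∀ᶠ z in nhds y, ∀ u v, Γ z u v = Γ z v u) (u v w : E) :
    localCurvature Γ y u v w + localCurvature Γ y v w u + localCurvature Γ y w u v = 0 := by
  have hD : ∀ a b c, fderiv ℝ Γ y a b c = fderiv ℝ Γ y a c b := by
    intro a b c
    rw [← fderiv_clm_apply_apply_const hΓ, ← fderiv_clm_apply_apply_const hΓ]
    have : (fun z => Γ z b c) =ᶠ[nhds y] fun z => Γ z c b := hs.mono fun z h => h b c
    rw [this.fderiv_eq]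
  have h := hs.self_of_nhds
  simp only [localCurvature]
  rw [hD u w v, hD v w u, hD w v u, h v w, h u w, h v u]
  abel

/-- The function $z\mapsto G_z(w,x)$ has symmetric second derivatives. Expanding both orders of
differentiation with the compatibility of `Γ` and subtracting leaves $G(R(u,v)w,x)+G(w,R(u,v)x)=0$.
-/
theorem localCurvature_metric_skew (hG : ContDiffAt ℝ 2 G y) (hΓ : DifferentiableAt ℝ Γ y)
    (hc : ∀ᶠ z in nhds y, ∀ a b c, fderiv ℝ G z a b c = G z (Γ z a b) c + G z b (Γ z a c))
    (u v w x : E) :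
    G y (localCurvature Γ y u v w) x = -G y w (localCurvature Γ y u v x) := by
  have hG1 : DifferentiableAt ℝ G y := hG.differentiableAt (by norm_num)
  have hf : ContDiffAt ℝ 2 (fun z => G z w x) y :=
    (hG.clm_apply contDiffAt_const).clm_apply contDiffAt_const
  have hf2 : DifferentiableAt ℝ (fderiv ℝ fun z => G z w x) y :=
    (hf.fderiv_right (m := 1) (by norm_num)).differentiableAt (by norm_num)
  have hsnd : ∀ a b, fderiv ℝ (fderiv ℝ fun z => G z w x) y a b =
      fderiv ℝ (fderiv ℝ fun z => G z w x) y b a := fun a b =>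
    (hf.isSymmSndFDerivAt (by simp)) a b
  have key : ∀ a b, fderiv ℝ (fderiv ℝ fun z => G z w x) y a b =
      fderiv ℝ G y a (Γ y b w) x + G y (fderiv ℝ Γ y a b w) x
        + (fderiv ℝ G y a w (Γ y b x) + G y w (fderiv ℝ Γ y a b x)) := by
    intro a b
    have e1 : HasFDerivAt (fun z => fderiv ℝ (fun z => G z w x) z b) _ y :=
      hf2.hasFDerivAt.clm_apply (hasFDerivAt_const b y)
    have e2 : ∀ d, HasFDerivAt (fun z => Γ z b d) _ y := fun d =>
      hasFDerivAt_clm_apply_apply hΓ.hasFDerivAt (hasFDerivAt_const b y) (hasFDerivAt_const d y)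
    have e3 := (hasFDerivAt_clm_apply_apply hG1.hasFDerivAt (e2 w) (hasFDerivAt_const x y)).add
      (hasFDerivAt_clm_apply_apply hG1.hasFDerivAt (hasFDerivAt_const w y) (e2 x))
    have e4 : (fun z => fderiv ℝ (fun z => G z w x) z b) =ᶠ[nhds y]
        fun z => G z (Γ z b w) x + G z w (Γ z b x) := by
      filter_upwards [hc, hG.eventually (by simp)] with z h hz
      rw [fderiv_clm_apply_apply_const (hz.differentiableAt (by norm_num)), h]
    have e5 := congrArg (fun L : E →L[ℝ] ℝ => L a) (e1.unique (e3.congr_of_eventuallyEq e4))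
    simp at e5
    rw [e5]
    ring
  have k1 := key u v
  have k2 := key v u
  rw [hsnd v u] at k2
  have h := hc.self_of_nhds
  simp only [h] at k1 k2
  simp only [localCurvature, map_add, map_sub, add_apply,
    sub_apply]
  linarith

/-- A formal consequence of the two antisymmetries and the first Bianchi identity: add the four
Bianchi identities obtained by cyclically permuting the four arguments. -/
theorem localCurvature_pair_symm (hG : ContDiffAt ℝ 2 G y) (hΓ : DifferentiableAt ℝ Γ y)
    (hsymm : ∀ u v, G y u v = G y v u)
    (hc : ∀ᶠ z in nhds y, ∀ a b c, fderiv ℝ G z a b c = G z (Γ z a b) c + G z b (Γ z a c))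
    (hs : ∀ᶠ z in nhds y, ∀ u v, Γ z u v = Γ z v u) (u v w x : E) :
    G y (localCurvature Γ y u v w) x = G y (localCurvature Γ y w x u) v := by
  have sk : ∀ a b c d, G y (localCurvature Γ y a b c) d = -G y (localCurvature Γ y a b d) c :=
    fun a b c d => by rw [localCurvature_metric_skew hG hΓ hc, hsymm]
  have sw : ∀ a b c d, G y (localCurvature Γ y a b c) d = -G y (localCurvature Γ y b a c) d :=
    fun a b c d => by rw [localCurvature_swap b a]; simp
  have bi : ∀ a b c d, G y (localCurvature Γ y a b c) d + G y (localCurvature Γ y b c a) d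
      + G y (localCurvature Γ y c a b) d = 0 := fun a b c d => by
    rw [← add_apply, ← map_add, ← add_apply, ← map_add,
      localCurvature_bianchi hΓ hs]
    simp
  linarith [bi u v w x, bi v w x u, bi w x u v, bi x u v w, sk u v w x, sk v w u x, sk w u v x,
    sk v w x u, sk w x v u, sk x v w u, sk w x u v, sk x u w v, sk u w x v, sk x u v w,
    sk u v x w, sk v x u w, sw w u v x, sw u w v x, sw v x u w, sw x v u w, sw w u x v,
    sw x v w u, sw u w x v, sw v x w u]

end Curvature

end LocalMetric

/-! ### Components of tangent vectors and of the metric in charts -/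

section Charts

variable {n : ℕ} {M : Type*} [TopologicalSpace M] [ChartedSpace (EuclideanSpace ℝ (Fin n)) M]
  [IsManifold (𝓡 n) ∞ M]

/-- The components of a tangent vector at `x` in the preferred chart at `p`. -/
def chartVec (p x : M) (v : TangentSpace (𝓡 n) x) : EuclideanSpace ℝ (Fin n) :=
  (trivializationAt (EuclideanSpace ℝ (Fin n)) (TangentSpace (𝓡 n) : M → Type _) p
    (TotalSpace.mk' (EuclideanSpace ℝ (Fin n)) x v)).2

theorem chartVec_add (p x : M) (u v : TangentSpace (𝓡 n) x) :
    chartVec p x (u + v) = chartVec p x u + chartVec p x v :=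
  (tangentCoordChange (𝓡 n) x p x).map_add u v

theorem chartVec_smul (p x : M) (a : ℝ) (v : TangentSpace (𝓡 n) x) :
    chartVec p x (a • v) = a • chartVec p x v :=
  (tangentCoordChange (𝓡 n) x p x).map_smul a v

theorem chartVec_self (x : M) (v : TangentSpace (𝓡 n) x) : chartVec x x v = v :=
  tangentCoordChange_self (mem_extChartAt_source x)

theorem symmL_chartVec {p x : M} (hx : x ∈ (chartAt (EuclideanSpace ℝ (Fin n)) p).source)
    (v : TangentSpace (𝓡 n) x) :
    (trivializationAt (EuclideanSpace ℝ (Fin n)) (TangentSpace (𝓡 n) : M → Type _) p).symmL ℝ x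
      (chartVec p x v) = v := by
  have := (trivializationAt (EuclideanSpace ℝ (Fin n))
    (TangentSpace (𝓡 n) : M → Type _) p).symmL_continuousLinearMapAt (R := ℝ) (b := x) hx v
  rw [Trivialization.continuousLinearMapAt_apply, Trivialization.coe_linearMapAt_of_mem _ hx] at this
  exact this

theorem chartVec_symmL {p x : M} (hx : x ∈ (chartAt (EuclideanSpace ℝ (Fin n)) p).source)
    (v : EuclideanSpace ℝ (Fin n)) :
    chartVec p x ((trivializationAt (EuclideanSpace ℝ (Fin n))
      (TangentSpace (𝓡 n) : M → Type _) p).symmL ℝ x v) = v := by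
  have := (trivializationAt (EuclideanSpace ℝ (Fin n))
    (TangentSpace (𝓡 n) : M → Type _) p).continuousLinearMapAt_symmL (R := ℝ) (b := x) hx v
  rw [Trivialization.continuousLinearMapAt_apply, Trivialization.coe_linearMapAt_of_mem _ hx] at this
  exact this

theorem chartVec_surjective {p x : M} (hx : x ∈ (chartAt (EuclideanSpace ℝ (Fin n)) p).source) :
    Function.Surjective (chartVec (n := n) p x) := fun v => ⟨_, chartVec_symmL hx v⟩

theorem chartVec_injective {p x : M} (hx : x ∈ (chartAt (EuclideanSpace ℝ (Fin n)) p).source) :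
    Function.Injective (chartVec (n := n) p x) := fun u v h => by
  rw [← symmL_chartVec hx u, h, symmL_chartVec hx]

/-- The change of coordinates from the preferred chart at `q` to the preferred chart at `p`. -/
def transition (n : ℕ) {M : Type*} [TopologicalSpace M]
    [ChartedSpace (EuclideanSpace ℝ (Fin n)) M] (p q : M) :
    EuclideanSpace ℝ (Fin n) → EuclideanSpace ℝ (Fin n) :=
  extChartAt (𝓡 n) p ∘ (extChartAt (𝓡 n) q).symm

theorem transition_apply {p q x : M} (hq : x ∈ (chartAt (EuclideanSpace ℝ (Fin n)) q).source) :
    transition n p q (extChartAt (𝓡 n) q x) = extChartAt (𝓡 n) p x := by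
  simp only [transition, Function.comp_apply]
  rw [(extChartAt (𝓡 n) q).left_inv (by simpa using hq)]

theorem contDiffAt_transition {p q x : M}
    (hp : x ∈ (chartAt (EuclideanSpace ℝ (Fin n)) p).source)
    (hq : x ∈ (chartAt (EuclideanSpace ℝ (Fin n)) q).source) :
    ContDiffAt ℝ ∞ (transition n p q) (extChartAt (𝓡 n) q x) := by
  have h : extChartAt (𝓡 n) q x ∈
      ((extChartAt (𝓡 n) q).symm ≫ (extChartAt (𝓡 n) p)).source := by
    rw [PartialEquiv.trans_source'', PartialEquiv.symm_symm, PartialEquiv.symm_target]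
    exact mem_image_of_mem _ ⟨by simpa using hq, by simpa using hp⟩
  have := contDiffWithinAt_ext_coord_change (n := ∞) p q h
  rwa [ModelWithCorners.range_eq_univ, contDiffWithinAt_univ] at this

/-- This is the cocycle relation of the tangent bundle from the chart at `x` through the chart at
`q` to the chart at `p`; the second coordinate change is by definition the derivative of the
transition map. -/
theorem fderiv_transition_chartVec {p q x : M}
    (hp : x ∈ (chartAt (EuclideanSpace ℝ (Fin n)) p).source)
    (hq : x ∈ (chartAt (EuclideanSpace ℝ (Fin n)) q).source) (v : TangentSpace (𝓡 n) x) :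
    fderiv ℝ (transition n p q) (extChartAt (𝓡 n) q x) (chartVec q x v) = chartVec p x v := by
  have h := tangentCoordChange_comp (I := 𝓡 n) (w := x) (x := q) (y := p) (z := x)
    (v := (v : EuclideanSpace ℝ (Fin n)))
    ⟨⟨mem_extChartAt_source x, by simpa using hq⟩, by simpa using hp⟩
  rw [tangentCoordChange_def (x := q), ModelWithCorners.range_eq_univ, fderivWithin_univ] at h
  exact h

theorem extChartAt_symm_mem_source {p : M} {y : EuclideanSpace ℝ (Fin n)}
    (hy : y ∈ (extChartAt (𝓡 n) p).target) :
    (extChartAt (𝓡 n) p).symm y ∈ (chartAt (EuclideanSpace ℝ (Fin n)) p).source := by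
  simpa using (extChartAt (𝓡 n) p).map_target hy

variable [RiemannianBundle (fun x : M => TangentSpace (𝓡 n) x)]

theorem metricInChart_chartVec {p x : M}
    (hx : x ∈ (chartAt (EuclideanSpace ℝ (Fin n)) p).source) (u v : TangentSpace (𝓡 n) x) :
    metricInChart p (extChartAt (𝓡 n) p x) (chartVec p x u) (chartVec p x v) = inner ℝ u v := by
  simp only [metricInChart]
  have hsymm : ∀ w : TangentSpace (𝓡 n) x, ∀ z, z = x →
      (trivializationAt (EuclideanSpace ℝ (Fin n)) (TangentSpace (𝓡 n) : M → Type _) p).symmL ℝ z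
      (chartVec p x w) = (w : EuclideanSpace ℝ (Fin n)) := by
    rintro w z rfl
    exact symmL_chartVec hx w
  -- The base point in `metricInChart` is the inverse chart applied to the chart image of `x`, which
  -- equals `x` only propositionally. Generalising it lets the equation be substituted in the
  -- dependent type.
  have key : ∀ z : M, z = x → (inner ℝ
      ((trivializationAt (EuclideanSpace ℝ (Fin n)) (TangentSpace (𝓡 n) : M → Type _) p).symmL ℝ z
        (chartVec p x u))
      ((trivializationAt (EuclideanSpace ℝ (Fin n)) (TangentSpace (𝓡 n) : M → Type _) p).symmL ℝ z
        (chartVec p x v)) : ℝ) = inner ℝ u v := by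
    rintro z rfl
    rw [symmL_chartVec hx, symmL_chartVec hx]
  exact key _ ((extChartAt (𝓡 n) p).left_inv (by simpa using hx))

/-- `metricInChart` as a bilinear form. -/
def metricForm (p : M) (y : EuclideanSpace ℝ (Fin n)) :
    EuclideanSpace ℝ (Fin n) →L[ℝ] EuclideanSpace ℝ (Fin n) →L[ℝ] ℝ :=
  LinearMap.toContinuousLinearMap
    (LinearMap.toContinuousLinearMap.toLinearMap ∘ₗ
      LinearMap.mk₂ ℝ (metricInChart p y)
        (fun u u' v => by simp only [metricInChart, map_add, inner_add_left])
        (fun a u v => by simp only [metricInChart, map_smul, real_inner_smul_left, smul_eq_mul])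
        (fun u v v' => by simp only [metricInChart, map_add, inner_add_right])
        (fun a u v => by simp only [metricInChart, map_smul, real_inner_smul_right, smul_eq_mul]))

@[simp] theorem metricForm_apply (p : M) (y u v : EuclideanSpace ℝ (Fin n)) :
    metricForm p y u v = metricInChart p y u v := rfl

theorem metricForm_symm (p : M) (y u v : EuclideanSpace ℝ (Fin n)) :
    metricForm p y u v = metricForm p y v u := by
  simp only [metricForm_apply, metricInChart]
  exact real_inner_comm _ _

theorem metricForm_chartVec {p x : M}
    (hx : x ∈ (chartAt (EuclideanSpace ℝ (Fin n)) p).source) (u v : TangentSpace (𝓡 n) x) :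
    metricForm p (extChartAt (𝓡 n) p x) (chartVec p x u) (chartVec p x v) = inner ℝ u v :=
  metricInChart_chartVec hx u v

theorem metricForm_self_eq_zero {p : M} {y : EuclideanSpace ℝ (Fin n)}
    (hy : y ∈ (extChartAt (𝓡 n) p).target) (u : EuclideanSpace ℝ (Fin n))
    (hu : metricForm p y u u = 0) : u = 0 := by
  simp only [metricForm_apply, metricInChart] at hu
  have h := inner_self_eq_zero.1 hu
  have hx := extChartAt_symm_mem_source hy
  have := chartVec_symmL hx u
  rw [h] at this
  rw [← this, ← zero_smul ℝ (0 : TangentSpace (𝓡 n) ((extChartAt (𝓡 n) p).symm y)),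
    chartVec_smul, zero_smul]

variable [IsContMDiffRiemannianBundle (𝓡 n) ∞ (EuclideanSpace ℝ (Fin n))
      (fun x : M => TangentSpace (𝓡 n) x)]

/-- In finite dimension smoothness of a form-valued map can be tested on fixed vectors, and a fixed
vector of components is a smooth section over the chart domain. -/
theorem contDiffOn_metricForm (p : M) :
    ContDiffOn ℝ ∞ (metricForm (n := n) p) (extChartAt (𝓡 n) p).target := by
  rw [contDiffOn_clm_apply]
  intro u
  rw [contDiffOn_clm_apply]
  intro v
  rw [← contMDiffOn_iff_contDiffOn]
  have hsec : ∀ w : EuclideanSpace ℝ (Fin n), ContMDiffOn 𝓘(ℝ, EuclideanSpace ℝ (Fin n))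
      (𝓡 n).tangent ∞ (fun y => (⟨(extChartAt (𝓡 n) p).symm y,
        (trivializationAt (EuclideanSpace ℝ (Fin n)) (TangentSpace (𝓡 n) : M → Type _) p).symmL ℝ
          ((extChartAt (𝓡 n) p).symm y) w⟩ : TangentBundle (𝓡 n) M))
      (extChartAt (𝓡 n) p).target := by
    intro w
    have h1 := (trivializationAt (EuclideanSpace ℝ (Fin n))
      (TangentSpace (𝓡 n) : M → Type _) p).contMDiffOn_symm (IB := 𝓡 n) (n := ∞)
    have h2 : ContMDiffOn 𝓘(ℝ, EuclideanSpace ℝ (Fin n))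
        ((𝓡 n).prod 𝓘(ℝ, EuclideanSpace ℝ (Fin n))) ∞
        (fun y => ((extChartAt (𝓡 n) p).symm y, w)) (extChartAt (𝓡 n) p).target :=
      (contMDiffOn_extChartAt_symm p).prodMk contMDiffOn_const
    have h3 := h1.comp h2 (fun y hy => by
      simpa using extChartAt_symm_mem_source hy)
    refine h3.congr fun y hy => ?_
    have hx := extChartAt_symm_mem_source hy
    simp only [Function.comp_apply]
    rw [← Trivialization.mk_symm _ hx, Trivialization.symmL_apply _ hx]
  exact (hsec u).inner_bundle (hsec v)

end Charts

/-! ### Smoothness of the inverse matrix -/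

section MatrixSmooth

variable {ι F : Type*} [Fintype ι] [DecidableEq ι] [NormedAddCommGroup F] [NormedSpace ℝ F]
  {A : F → Matrix ι ι ℝ} {s : Set F}

theorem contDiffOn_matrix_det (hA : ∀ i j, ContDiffOn ℝ ∞ (fun y => A y i j) s) :
    ContDiffOn ℝ ∞ (fun y => (A y).det) s := by
  simp only [Matrix.det_apply]
  exact ContDiffOn.sum fun σ _ => (contDiffOn_prod fun i _ => hA _ _).const_smul _

/-- Cramer's rule: each entry is a determinant divided by the determinant of `A`. -/
theorem contDiffOn_matrix_inv (hA : ∀ i j, ContDiffOn ℝ ∞ (fun y => A y i j) s)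
    (hdet : ∀ y ∈ s, (A y).det ≠ 0) (i j : ι) :
    ContDiffOn ℝ ∞ (fun y => (A y)⁻¹ i j) s := by
  simp only [Matrix.inv_def, Matrix.smul_apply, Ring.inverse_eq_inv', smul_eq_mul,
    Matrix.adjugate_apply]
  refine ((contDiffOn_matrix_det hA).inv hdet).mul (contDiffOn_matrix_det fun k l => ?_)
  simp only [Matrix.updateRow_apply]
  split_ifs
  · exact contDiffOn_const
  · exact hA k l

end MatrixSmooth

theorem eq_sum_stdVec {n : ℕ} (u : EuclideanSpace ℝ (Fin n)) : u = ∑ k, u k • stdVec n k := by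
  ext i
  simp [stdVec, Finset.sum_apply, Pi.single_apply]

/-! ### Christoffel symbols in charts and their transformation law -/

section Christoffel

variable {n : ℕ} {M : Type*} [TopologicalSpace M] [ChartedSpace (EuclideanSpace ℝ (Fin n)) M]
  [IsManifold (𝓡 n) ∞ M] [RiemannianBundle (fun x : M => TangentSpace (𝓡 n) x)]

/-- The Christoffel symbols as a continuous bilinear map. -/
def christoffelForm (p : M) (y : EuclideanSpace ℝ (Fin n)) :
    EuclideanSpace ℝ (Fin n) →L[ℝ] EuclideanSpace ℝ (Fin n) →L[ℝ] EuclideanSpace ℝ (Fin n) :=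
  LinearMap.toContinuousLinearMap
    (LinearMap.toContinuousLinearMap.toLinearMap ∘ₗ
      LinearMap.mk₂ ℝ (fun u v => ∑ k, (∑ l, inverseMetric p y k l * ((1 / 2 : ℝ) *
          (fderiv ℝ (metricForm p) y u v (stdVec n l) + fderiv ℝ (metricForm p) y v u (stdVec n l)
            - fderiv ℝ (metricForm p) y (stdVec n l) u v))) • stdVec n k)
        (fun u u' v => by
          simp only [← Finset.sum_add_distrib, ← add_smul, ContinuousLinearMap.map_add, add_apply]
          refine Finset.sum_congr rfl fun k _ => ?_
          congr 1
          exact Finset.sum_congr rfl fun l _ => by ring)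
        (fun a u v => by
          simp only [Finset.smul_sum, smul_smul, ContinuousLinearMap.map_smul, smul_apply, smul_eq_mul,
            Finset.mul_sum]
          refine Finset.sum_congr rfl fun k _ => ?_
          congr 1
          exact Finset.sum_congr rfl fun l _ => by ring)
        (fun u v v' => by
          simp only [← Finset.sum_add_distrib, ← add_smul, ContinuousLinearMap.map_add, add_apply]
          refine Finset.sum_congr rfl fun k _ => ?_
          congr 1
          exact Finset.sum_congr rfl fun l _ => by ring)
        (fun a u v => by
          simp only [Finset.smul_sum, smul_smul, ContinuousLinearMap.map_smul, smul_apply, smul_eq_mul,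
            Finset.mul_sum]
          refine Finset.sum_congr rfl fun k _ => ?_
          congr 1
          exact Finset.sum_congr rfl fun l _ => by ring))

theorem christoffelForm_apply (p : M) (y u v : EuclideanSpace ℝ (Fin n)) :
    christoffelForm p y u v = ∑ k, (∑ l, inverseMetric p y k l * ((1 / 2 : ℝ) *
      (fderiv ℝ (metricForm p) y u v (stdVec n l) + fderiv ℝ (metricForm p) y v u (stdVec n l)
        - fderiv ℝ (metricForm p) y (stdVec n l) u v))) • stdVec n k := rfl

theorem gram_mulVec (p : M) (y : EuclideanSpace ℝ (Fin n)) (a : Fin n → ℝ) (m : Fin n) :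
    Matrix.mulVec (Matrix.of fun k l => metricInChart p y (stdVec n k) (stdVec n l)) a m
      = metricForm p y (∑ k, a k • stdVec n k) (stdVec n m) := by
  simp only [Matrix.mulVec, dotProduct, Matrix.of_apply, map_sum, map_smul, sum_apply,
    smul_apply, smul_eq_mul]
  refine Finset.sum_congr rfl fun k _ => ?_
  rw [← metricForm_apply, metricForm_symm, mul_comm]

/-- A null vector of the Gram matrix would give the components of a nonzero vector of length zero.
-/
theorem det_gram_ne_zero {p : M} {y : EuclideanSpace ℝ (Fin n)}
    (hy : y ∈ (extChartAt (𝓡 n) p).target) :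
    (Matrix.of fun k l => metricInChart p y (stdVec n k) (stdVec n l)).det ≠ 0 := by
  intro h
  obtain ⟨a, ha, h0⟩ := Matrix.exists_mulVec_eq_zero_iff.2 h
  apply ha
  have h1 : metricForm p y (∑ k, a k • stdVec n k) (∑ k, a k • stdVec n k) = 0 := by
    rw [map_sum]
    refine Finset.sum_eq_zero fun m _ => ?_
    rw [map_smul, ← gram_mulVec, h0]
    simp
  have h2 := metricForm_self_eq_zero hy _ h1
  ext i
  have := congrArg (fun z : EuclideanSpace ℝ (Fin n) => z i) h2
  simpa [stdVec, Pi.single_apply] using this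

/-- Pairing with a basis vector multiplies by the Gram matrix and cancels its inverse; linearity in
`w` does the rest. -/
theorem isKoszul_christoffelForm {p : M} {y : EuclideanSpace ℝ (Fin n)}
    (hy : y ∈ (extChartAt (𝓡 n) p).target) :
    IsKoszul (metricForm p) y (christoffelForm p y) := by
  intro u v w
  set K : Fin n → ℝ := fun l => fderiv ℝ (metricForm p) y u v (stdVec n l)
    + fderiv ℝ (metricForm p) y v u (stdVec n l) - fderiv ℝ (metricForm p) y (stdVec n l) u v
    with hK
  have hbasis : ∀ m, metricForm p y (christoffelForm p y u v) (stdVec n m) = (1 / 2) * K m := by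
    intro m
    rw [christoffelForm_apply, ← gram_mulVec]
    have : (fun k => ∑ l, inverseMetric p y k l * ((1 / 2 : ℝ) * K l)) =
        Matrix.mulVec (inverseMetric p y) (fun l => (1 / 2 : ℝ) * K l) := rfl
    change Matrix.mulVec _ (fun k => ∑ l, inverseMetric p y k l * ((1 / 2 : ℝ) * K l)) m = _
    rw [this, Matrix.mulVec_mulVec, inverseMetric, Matrix.mul_nonsing_inv _
      (isUnit_iff_ne_zero.2 (det_gram_ne_zero hy)), Matrix.one_mulVec]
  rw [eq_sum_stdVec w]
  simp only [map_sum, map_smul, hbasis, sum_apply, smul_apply, smul_eq_mul, hK,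
    Finset.mul_sum, ← Finset.sum_add_distrib, ← Finset.sum_sub_distrib]
  exact Finset.sum_congr rfl fun l _ => by ring

variable [IsContMDiffRiemannianBundle (𝓡 n) ∞ (EuclideanSpace ℝ (Fin n))
      (fun x : M => TangentSpace (𝓡 n) x)]

theorem contDiffAt_metricForm {p : M} {y : EuclideanSpace ℝ (Fin n)}
    (hy : y ∈ (extChartAt (𝓡 n) p).target) : ContDiffAt ℝ ∞ (metricForm p) y :=
  (contDiffOn_metricForm p).contDiffAt ((isOpen_extChartAt_target p).mem_nhds hy)

/-- One side differentiates the form-valued metric, so that it is bilinear at every `y`; the other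
differentiates the coefficients for fixed vectors. They agree where the metric is differentiable,
hence on the chart target. -/
theorem christoffelForm_eq {p : M} {y : EuclideanSpace ℝ (Fin n)}
    (hy : y ∈ (extChartAt (𝓡 n) p).target) (u v : EuclideanSpace ℝ (Fin n)) :
    christoffelForm p y u v = christoffel p y u v := by
  have h := fderiv_clm_apply_apply_const
    ((contDiffAt_metricForm hy).differentiableAt (by simp))
  simp only [metricForm_apply] at h
  simp only [christoffel, christoffelForm_apply, h]

theorem contDiffOn_christoffelForm (p : M) :
    ContDiffOn ℝ ∞ (christoffelForm (n := n) p) (extChartAt (𝓡 n) p).target := by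
  have hopen : IsOpen (extChartAt (𝓡 n) p).target := isOpen_extChartAt_target p
  rw [contDiffOn_clm_apply]
  intro u
  rw [contDiffOn_clm_apply]
  intro v
  simp only [christoffelForm_apply]
  have hinv := contDiffOn_matrix_inv (s := (extChartAt (𝓡 n) p).target)
    (A := fun y => Matrix.of fun k l => metricInChart p y (stdVec n k) (stdVec n l))
    (fun k l => ((contDiffOn_metricForm p).clm_apply contDiffOn_const).clm_apply contDiffOn_const)
    (fun y hy => det_gram_ne_zero hy)
  have hD : ∀ a b c, ContDiffOn ℝ ∞ (fun y => fderiv ℝ (metricForm p) y a b c)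
      (extChartAt (𝓡 n) p).target := fun a b c =>
    ((((contDiffOn_metricForm p).fderiv_of_isOpen hopen (m := ∞) le_rfl).clm_apply
      contDiffOn_const).clm_apply contDiffOn_const).clm_apply contDiffOn_const
  refine ContDiffOn.sum fun k _ => ?_
  have hcoeff : ContDiffOn ℝ ∞ (fun y => ∑ l, inverseMetric p y k l * ((1 / 2 : ℝ) *
      (fderiv ℝ (metricForm p) y u v (stdVec n l) + fderiv ℝ (metricForm p) y v u (stdVec n l)
        - fderiv ℝ (metricForm p) y (stdVec n l) u v))) (extChartAt (𝓡 n) p).target :=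
    ContDiffOn.sum fun l _ =>
      (hinv k l).mul (contDiffOn_const.mul (((hD _ _ _).add (hD _ _ _)).sub (hD _ _ _)))
  exact hcoeff.smul contDiffOn_const

theorem contDiffAt_christoffelForm {p : M} {y : EuclideanSpace ℝ (Fin n)}
    (hy : y ∈ (extChartAt (𝓡 n) p).target) : ContDiffAt ℝ ∞ (christoffelForm p) y :=
  (contDiffOn_christoffelForm p).contDiffAt ((isOpen_extChartAt_target p).mem_nhds hy)

theorem metricForm_compatible {p : M} {y : EuclideanSpace ℝ (Fin n)}
    (hy : y ∈ (extChartAt (𝓡 n) p).target) (a b c : EuclideanSpace ℝ (Fin n)) :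
    fderiv ℝ (metricForm p) y a b c = metricForm p y (christoffelForm p y a b) c
      + metricForm p y b (christoffelForm p y a c) :=
  (isKoszul_christoffelForm hy).compatible
    ((contDiffAt_metricForm hy).differentiableAt (by simp))
    (.of_forall fun z => metricForm_symm p z) a b c

theorem christoffelForm_symm {p : M} {y : EuclideanSpace ℝ (Fin n)}
    (hy : y ∈ (extChartAt (𝓡 n) p).target) (u v : EuclideanSpace ℝ (Fin n)) :
    christoffelForm p y u v = christoffelForm p y v u :=
  (isKoszul_christoffelForm hy).symm
    ((contDiffAt_metricForm hy).differentiableAt (by simp))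
    (.of_forall fun z => metricForm_symm p z) (metricForm_self_eq_zero hy) u v

/-- The transformation law of the Christoffel symbols. -/
theorem fderiv_transition_christoffelForm {p q x : M}
    (hp : x ∈ (chartAt (EuclideanSpace ℝ (Fin n)) p).source)
    (hq : x ∈ (chartAt (EuclideanSpace ℝ (Fin n)) q).source) (u v : EuclideanSpace ℝ (Fin n)) :
    fderiv ℝ (transition n p q) (extChartAt (𝓡 n) q x)
        (christoffelForm q (extChartAt (𝓡 n) q x) u v) =
      christoffelForm p (extChartAt (𝓡 n) p x)
        (fderiv ℝ (transition n p q) (extChartAt (𝓡 n) q x) u)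
        (fderiv ℝ (transition n p q) (extChartAt (𝓡 n) q x) v)
      + fderiv ℝ (fderiv ℝ (transition n p q)) (extChartAt (𝓡 n) q x) u v := by
  have hp' : x ∈ (extChartAt (𝓡 n) p).source := by simpa using hp
  have hq' : x ∈ (extChartAt (𝓡 n) q).source := by simpa using hq
  have htp := (extChartAt (𝓡 n) p).map_source hp'
  have htq := (extChartAt (𝓡 n) q).map_source hq'
  have hφ := transition_apply (n := n) (p := p) hq
  -- The transition map is an isometry of the coordinate metrics near the point: both sides are the
  -- inner product of the same two tangent vectors of `M`.
  have hiso : ∀ᶠ z in nhds (extChartAt (𝓡 n) q x), ∀ u v, metricForm q z u v =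
      metricForm p (transition n p q z) (fderiv ℝ (transition n p q) z u)
        (fderiv ℝ (transition n p q) z v) := by
    have h1 : ∀ᶠ z in nhds (extChartAt (𝓡 n) q x), z ∈ (extChartAt (𝓡 n) q).target :=
      (isOpen_extChartAt_target q).mem_nhds htq
    have h2 : ∀ᶠ z in nhds (extChartAt (𝓡 n) q x),
        (extChartAt (𝓡 n) q).symm z ∈ (chartAt (EuclideanSpace ℝ (Fin n)) p).source := by
      apply ((contMDiffOn_extChartAt_symm (n := ∞) q).continuousOn.continuousAt
        ((isOpen_extChartAt_target q).mem_nhds htq)).eventually_mem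
      rw [(extChartAt (𝓡 n) q).left_inv hq']
      exact (chartAt _ p).open_source.mem_nhds hp
    filter_upwards [h1, h2] with z hz hzp u v
    have hzq := extChartAt_symm_mem_source hz
    obtain ⟨u, rfl⟩ := chartVec_surjective hzq u
    obtain ⟨v, rfl⟩ := chartVec_surjective hzq v
    have e : extChartAt (𝓡 n) q ((extChartAt (𝓡 n) q).symm z) = z :=
      (extChartAt (𝓡 n) q).right_inv hz
    have f1 := fderiv_transition_chartVec hzp hzq
    have f2 := transition_apply (n := n) (p := p) hzq
    have f3 := metricForm_chartVec hzq u v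
    rw [e] at f1 f2 f3
    rw [f1, f1, f2, f3, metricForm_chartVec hzp]
  have hsurj : Function.Surjective (fderiv ℝ (transition n p q) (extChartAt (𝓡 n) q x)) := by
    intro w
    obtain ⟨w, rfl⟩ := chartVec_surjective hp w
    exact ⟨_, fderiv_transition_chartVec hp hq w⟩
  have h := IsKoszul.transform (φ := transition n p q) (isKoszul_christoffelForm htq)
    (Γ₂ := christoffelForm p (extChartAt (𝓡 n) p x)) (G₂ := metricForm p)
    (by rw [hφ]; exact isKoszul_christoffelForm htp)
    (by rw [hφ]; exact (contDiffAt_metricForm htp).differentiableAt (by simp))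
    ((contDiffAt_metricForm htq).differentiableAt (by simp))
    (.of_forall fun z => metricForm_symm p z)
    (by rw [hφ]; exact metricForm_self_eq_zero htp)
    ((contDiffAt_transition hp hq).of_le ENat.LEInfty.out) hiso hsurj u v
  exact h

theorem riemannCurvature_eq (p : M) (u v w : EuclideanSpace ℝ (Fin n)) :
    riemannCurvature (n := n) p u v w =
      localCurvature (christoffelForm p) (extChartAt (𝓡 n) p p) u v w := by
  have hy := mem_extChartAt_target (I := 𝓡 n) p
  have hΓ : DifferentiableAt ℝ (christoffelForm p) (extChartAt (𝓡 n) p p) :=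
    (contDiffAt_christoffelForm hy).differentiableAt (by simp)
  have hD : ∀ a b c : EuclideanSpace ℝ (Fin n),
      fderiv ℝ (fun z => christoffel p z b c) (extChartAt (𝓡 n) p p) a =
      fderiv ℝ (christoffelForm p) (extChartAt (𝓡 n) p p) a b c := by
    intro a b c
    rw [← fderiv_clm_apply_apply_const hΓ]
    have he : (fun z => christoffel p z b c) =ᶠ[nhds (extChartAt (𝓡 n) p p)]
        fun z => christoffelForm p z b c := by
      filter_upwards [(isOpen_extChartAt_target p).mem_nhds hy] with z hz
      exact (christoffelForm_eq hz b c).symm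
    rw [he.fderiv_eq]
  change (fderiv ℝ (fun z => christoffel p z v w) (extChartAt (𝓡 n) p p) u
    - fderiv ℝ (fun z => christoffel p z u w) (extChartAt (𝓡 n) p p) v
    + christoffel p (extChartAt (𝓡 n) p p) u (christoffel p (extChartAt (𝓡 n) p p) v w)
    - christoffel p (extChartAt (𝓡 n) p p) v (christoffel p (extChartAt (𝓡 n) p p) u w)
      : EuclideanSpace ℝ (Fin n)) = _
  rw [localCurvature, hD, hD, christoffelForm_eq hy, christoffelForm_eq hy, christoffelForm_eq hy,
    christoffelForm_eq hy]

end Christoffel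

/-! ### Covariant derivative along a curve, independent of the chart -/

section AlongCurve

variable {n : ℕ} {M : Type*} [TopologicalSpace M] [ChartedSpace (EuclideanSpace ℝ (Fin n)) M]
  [IsManifold (𝓡 n) ∞ M]
  {S : Set ℝ} {γ : ℝ → M} {t : ℝ}

theorem eventually_mem_chart_source (hγ : ContinuousWithinAt γ S t) {p : M}
    (hp : γ t ∈ (chartAt (EuclideanSpace ℝ (Fin n)) p).source) :
    ∀ᶠ τ in nhdsWithin t S, γ τ ∈ (chartAt (EuclideanSpace ℝ (Fin n)) p).source :=
  hγ.eventually_mem ((chartAt _ p).open_source.mem_nhds hp)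

/-- The velocity in the preferred chart at an arbitrary point. -/
theorem hasDerivWithinAt_extChartAt
    (hγ : MDifferentiableWithinAt 𝓘(ℝ, ℝ) (𝓡 n) γ S t) {p : M}
    (hp : γ t ∈ (chartAt (EuclideanSpace ℝ (Fin n)) p).source) :
    HasDerivWithinAt (fun τ => extChartAt (𝓡 n) p (γ τ))
      (chartVec p (γ t) (velocity S γ t)) S t := by
  have hself := mem_chart_source (EuclideanSpace ℝ (Fin n)) (γ t)
  have h1 : HasDerivWithinAt (fun τ => extChartAt (𝓡 n) (γ t) (γ τ))
      (velocity S γ t : EuclideanSpace ℝ (Fin n)) S t := by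
    have hset : (extChartAt 𝓘(ℝ, ℝ) t).symm ⁻¹' S ∩ range 𝓘(ℝ, ℝ) = S := by
      rw [ModelWithCorners.range_eq_univ, inter_univ]
      rfl
    have hd : DifferentiableWithinAt ℝ (fun τ => extChartAt (𝓡 n) (γ t) (γ τ)) S t := by
      have := hγ.differentiableWithinAt_writtenInExtChartAt
      rw [hset] at this
      exact this
    have hv : (velocity S γ t : EuclideanSpace ℝ (Fin n)) =
        fderivWithin ℝ (fun τ => extChartAt (𝓡 n) (γ t) (γ τ)) S t 1 := by
      simp only [velocity, hγ.mfderivWithin, hset]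
      rfl
    rw [hv]
    exact hd.hasFDerivWithinAt.hasDerivWithinAt
  -- The chart at `γ t` gives the velocity by definition; composing with the transition map carries
  -- it to the chart at `p`.
  have h2 : HasFDerivAt (transition n p (γ t)) _ (extChartAt (𝓡 n) (γ t) (γ t)) :=
    ((contDiffAt_transition hp hself).differentiableAt (by simp)).hasFDerivAt
  have h3 := h2.comp_hasDerivWithinAt t h1
  have h4 : fderiv ℝ (transition n p (γ t)) (extChartAt (𝓡 n) (γ t) (γ t))
      (velocity S γ t : EuclideanSpace ℝ (Fin n)) = chartVec p (γ t) (velocity S γ t) := by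
    rw [← fderiv_transition_chartVec hp hself, chartVec_self]
  rw [h4] at h3
  refine h3.congr_of_eventuallyEq ?_ (transition_apply hself).symm
  filter_upwards [eventually_mem_chart_source hγ.continuousWithinAt hself] with τ hτ
  exact (transition_apply hτ).symm

/-- Differentiability at `t` of a vector field along `γ`. -/
def DiffFieldAt (S : Set ℝ) (γ : ℝ → M) (V : ∀ t, TangentSpace (𝓡 n) (γ t)) (t : ℝ) : Prop :=
  DifferentiableWithinAt ℝ (fun τ => chartVec (γ t) (γ τ) (V τ)) S t

variable {V W : ∀ t, TangentSpace (𝓡 n) (γ t)}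

theorem DiffFieldAt.smul {f : ℝ → ℝ} (hf : DifferentiableWithinAt ℝ f S t)
    (hV : DiffFieldAt S γ V t) : DiffFieldAt S γ (fun τ => f τ • V τ) t := by
  simp only [DiffFieldAt, chartVec_smul]
  exact DifferentiableWithinAt.smul hf hV

variable [RiemannianBundle (fun x : M => TangentSpace (𝓡 n) x)]

theorem covDeriv_congr (ht : t ∈ S) (h : ∀ τ ∈ S, V τ = W τ) :
    covDeriv S γ V t = covDeriv S γ W t := by
  simp only [covDeriv]
  rw [h t ht]
  congr 1
  exact derivWithin_congr (fun τ hτ => by rw [h τ hτ]) (by rw [h t ht])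

variable [IsContMDiffRiemannianBundle (𝓡 n) ∞ (EuclideanSpace ℝ (Fin n))
      (fun x : M => TangentSpace (𝓡 n) x)]

/-- In the chart at `γ t` itself this is the defining formula, so no regularity of `V` or `γ` is
needed. The same formula in other charts requires the transformation law. -/
theorem chartVec_self_covDeriv (S : Set ℝ) (γ : ℝ → M) (V : ∀ t, TangentSpace (𝓡 n) (γ t))
    (t : ℝ) : chartVec (γ t) (γ t) (covDeriv S γ V t) =
      derivWithin (fun τ => chartVec (γ t) (γ τ) (V τ)) S t
      + christoffelForm (γ t) (extChartAt (𝓡 n) (γ t) (γ t))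
        (chartVec (γ t) (γ t) (velocity S γ t)) (chartVec (γ t) (γ t) (V t)) := by
  rw [christoffelForm_eq (mem_extChartAt_target (γ t)), chartVec_self, chartVec_self,
    chartVec_self]
  rfl

theorem covDeriv_add (hV : DiffFieldAt S γ V t) (hW : DiffFieldAt S γ W t) :
    covDeriv S γ (fun τ => V τ + W τ) t = covDeriv S γ V t + covDeriv S γ W t := by
  apply chartVec_injective (mem_chart_source (EuclideanSpace ℝ (Fin n)) (γ t))
  rw [chartVec_add, chartVec_self_covDeriv, chartVec_self_covDeriv, chartVec_self_covDeriv]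
  simp only [chartVec_add, map_add]
  rw [derivWithin_fun_add hV hW]
  abel

theorem covDeriv_smul {f : ℝ → ℝ} {f' : ℝ} (hf : HasDerivWithinAt f f' S t)
    (hS : UniqueDiffWithinAt ℝ S t) (hV : DiffFieldAt S γ V t) :
    covDeriv S γ (fun τ => f τ • V τ) t = f' • V t + f t • covDeriv S γ V t := by
  apply chartVec_injective (mem_chart_source (EuclideanSpace ℝ (Fin n)) (γ t))
  rw [chartVec_add, chartVec_smul, chartVec_smul, chartVec_self_covDeriv, chartVec_self_covDeriv]
  simp only [chartVec_smul, map_smul]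
  rw [(hf.fun_smul hV.hasDerivWithinAt).derivWithin hS, smul_add]
  abel

/-- The covariant derivative in the preferred chart at an arbitrary point. -/
theorem chartVec_covDeriv (hS : UniqueDiffWithinAt ℝ S t)
    (hγ : MDifferentiableWithinAt 𝓘(ℝ, ℝ) (𝓡 n) γ S t) {p : M}
    (hp : γ t ∈ (chartAt (EuclideanSpace ℝ (Fin n)) p).source)
    (hV : DifferentiableWithinAt ℝ (fun τ => chartVec p (γ τ) (V τ)) S t) :
    chartVec p (γ t) (covDeriv S γ V t) = derivWithin (fun τ => chartVec p (γ τ) (V τ)) S t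
      + christoffelForm p (extChartAt (𝓡 n) p (γ t)) (chartVec p (γ t) (velocity S γ t))
        (chartVec p (γ t) (V t)) := by
  have hself := mem_chart_source (EuclideanSpace ℝ (Fin n)) (γ t)
  -- `w` is the tangent vector whose components at `p` are the right-hand side. It is identified
  -- with the covariant derivative by comparing components in the chart at `γ t`.
  obtain ⟨w, hw⟩ := chartVec_surjective (n := n) hp
    (derivWithin (fun τ => chartVec p (γ τ) (V τ)) S t
      + christoffelForm p (extChartAt (𝓡 n) p (γ t)) (chartVec p (γ t) (velocity S γ t))
        (chartVec p (γ t) (V t)))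
  rw [← hw]
  congr 1
  have hψ := contDiffAt_transition (n := n) hself hp
  have hψ2 : HasFDerivAt (fderiv ℝ (transition n (γ t) p)) _ (extChartAt (𝓡 n) p (γ t)) :=
    ((hψ.fderiv_right (m := ∞) le_rfl).differentiableAt (by simp)).hasFDerivAt
  have hx := hasDerivWithinAt_extChartAt hγ hp
  have hψx : HasDerivWithinAt
      (fun τ => fderiv ℝ (transition n (γ t) p) (extChartAt (𝓡 n) p (γ τ)))
      (fderiv ℝ (fderiv ℝ (transition n (γ t) p)) (extChartAt (𝓡 n) p (γ t))
        (chartVec p (γ t) (velocity S γ t))) S t :=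
    HasFDerivAt.comp_hasDerivWithinAt (l := fderiv ℝ (transition n (γ t) p))
      (f := fun τ => extChartAt (𝓡 n) p (γ τ)) t hψ2 hx
  have h1 := hψx.clm_apply hV.hasDerivWithinAt
  have h2 := h1.congr_of_eventuallyEq (f₁ := fun τ => chartVec (γ t) (γ τ) (V τ)) (by
    filter_upwards [eventually_mem_chart_source hγ.continuousWithinAt hself,
      eventually_mem_chart_source hγ.continuousWithinAt hp] with τ h3 h4
    exact (fderiv_transition_chartVec h3 h4 (V τ)).symm)
    (fderiv_transition_chartVec hself hp (V t)).symm
  -- The term with the second derivative of the transition map in the transformation law is the one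
  -- that arises in `h2` from differentiating $D\psi(x(\tau))$ along the curve.
  have h3 := fderiv_transition_chartVec hself hp w
  rw [hw, map_add, fderiv_transition_christoffelForm hself hp, fderiv_transition_chartVec hself hp,
    fderiv_transition_chartVec hself hp] at h3
  apply chartVec_injective hself
  rw [← h3, chartVec_self_covDeriv, h2.derivWithin hS]
  abel

/-- The Levi-Civita connection is metric. -/
theorem hasDerivWithinAt_inner (hS : UniqueDiffWithinAt ℝ S t)
    (hγ : MDifferentiableWithinAt 𝓘(ℝ, ℝ) (𝓡 n) γ S t)
    (hV : DiffFieldAt S γ V t) (hW : DiffFieldAt S γ W t) :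
    HasDerivWithinAt (fun τ => (inner ℝ (V τ) (W τ) : ℝ))
      (inner ℝ (covDeriv S γ V t) (W t) + inner ℝ (V t) (covDeriv S γ W t)) S t := by
  have hself := mem_chart_source (EuclideanSpace ℝ (Fin n)) (γ t)
  have hy := mem_extChartAt_target (I := 𝓡 n) (γ t)
  have hx := hasDerivWithinAt_extChartAt hγ hself
  have hG : HasFDerivAt (metricForm (γ t)) _ (extChartAt (𝓡 n) (γ t) (γ t)) :=
    ((contDiffAt_metricForm hy).differentiableAt (by simp)).hasFDerivAt
  have hGx : HasDerivWithinAt (fun τ => metricForm (γ t) (extChartAt (𝓡 n) (γ t) (γ τ)))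
      (fderiv ℝ (metricForm (γ t)) (extChartAt (𝓡 n) (γ t) (γ t))
        (chartVec (γ t) (γ t) (velocity S γ t))) S t :=
    HasFDerivAt.comp_hasDerivWithinAt (l := metricForm (γ t))
      (f := fun τ => extChartAt (𝓡 n) (γ t) (γ τ)) t hG hx
  have h1 := (hGx.clm_apply hV.hasDerivWithinAt).clm_apply
    hW.hasDerivWithinAt
  have h2 := h1.congr_of_eventuallyEq (f₁ := fun τ => (inner ℝ (V τ) (W τ) : ℝ)) (by
    filter_upwards [eventually_mem_chart_source hγ.continuousWithinAt hself] with τ hτ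
    exact (metricForm_chartVec hτ _ _).symm) (metricForm_chartVec hself _ _).symm
  refine h2.congr_deriv ?_
  rw [← metricForm_chartVec hself, ← metricForm_chartVec hself,
    chartVec_covDeriv hS hγ hself hV, chartVec_covDeriv hS hγ hself hW]
  simp only [add_apply, map_add, metricForm_compatible hy]
  ring

end AlongCurve

/-! ### Partial derivatives on rectangles with boundary -/

section Slices

/-- A convex set of parameters with nonempty interior. -/
structure IsParamInterval (A : Set ℝ) : Prop where
  convex : Convex ℝ A
  nonempty : (interior A).Nonempty

variable {A B : Set ℝ} {F : Type*} [NormedAddCommGroup F] [NormedSpace ℝ F]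

theorem IsParamInterval.uniqueDiffOn (hA : IsParamInterval A) : UniqueDiffOn ℝ A :=
  uniqueDiffOn_convex hA.convex hA.nonempty

theorem IsParamInterval.prod_subset_closure (hA : IsParamInterval A) (hB : IsParamInterval B) :
    A ×ˢ B ⊆ closure (interior (A ×ˢ B)) := by
  rw [interior_prod_eq, closure_prod_eq,
    hA.convex.closure_interior_eq_closure_of_nonempty_interior hA.nonempty,
    hB.convex.closure_interior_eq_closure_of_nonempty_interior hB.nonempty]
  exact prod_mono subset_closure subset_closure

/-- The partial derivative in the first variable, in the domain `A`. -/
def partialFst (A : Set ℝ) (f : ℝ × ℝ → F) (z : ℝ × ℝ) : F :=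
  derivWithin (fun σ => f (σ, z.2)) A z.1

/-- The partial derivative in the second variable, in the domain `B`. -/
def partialSnd (B : Set ℝ) (f : ℝ × ℝ → F) (z : ℝ × ℝ) : F :=
  derivWithin (fun τ => f (z.1, τ)) B z.2

variable {f : ℝ × ℝ → F} {z : ℝ × ℝ} {Q : Set (ℝ × ℝ)}

/-- `Q` is relatively open in the rectangle `A ×ˢ B`. -/
def IsRelOpen (A B : Set ℝ) (Q : Set (ℝ × ℝ)) : Prop := ∃ W, IsOpen W ∧ Q = A ×ˢ B ∩ W

theorem IsRelOpen.subset (hQ : IsRelOpen A B Q) : Q ⊆ A ×ˢ B := by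
  obtain ⟨W, -, rfl⟩ := hQ
  exact inter_subset_left

theorem IsRelOpen.mem_nhdsWithin (hQ : IsRelOpen A B Q) (hz : z ∈ Q) :
    Q ∈ nhdsWithin z (A ×ˢ B) := by
  obtain ⟨W, hW, rfl⟩ := hQ
  exact Filter.inter_mem self_mem_nhdsWithin (mem_nhdsWithin_of_mem_nhds (hW.mem_nhds hz.2))

theorem IsRelOpen.uniqueDiffOn (hQ : IsRelOpen A B Q) (hA : IsParamInterval A)
    (hB : IsParamInterval B) : UniqueDiffOn ℝ Q := by
  obtain ⟨W, hW, rfl⟩ := hQ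
  exact (hA.uniqueDiffOn.prod hB.uniqueDiffOn).inter hW

theorem IsRelOpen.subset_closure (hQ : IsRelOpen A B Q) (hA : IsParamInterval A)
    (hB : IsParamInterval B) : Q ⊆ closure (interior Q) := by
  obtain ⟨W, hW, rfl⟩ := hQ
  rw [interior_inter, hW.interior_eq]
  intro z hz
  rw [inter_comm]
  exact hW.inter_closure ⟨hz.2, hA.prod_subset_closure hB hz.1⟩

/-- Differentiability within `Q` suffices for a derivative along the whole side `A`, because `Q` is
a neighbourhood of `z` within the rectangle. -/
theorem hasDerivWithinAt_slice_fst (hQ : IsRelOpen A B Q) (hz : z ∈ Q)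
    (hf : DifferentiableWithinAt ℝ f Q z) :
    HasDerivWithinAt (fun σ => f (σ, z.2)) (fderivWithin ℝ f Q z (1, 0)) A z.1 := by
  have h1 : HasFDerivWithinAt f (fderivWithin ℝ f Q z) (A ×ˢ B) (z.1, z.2) :=
    hf.hasFDerivWithinAt.mono_of_mem_nhdsWithin (hQ.mem_nhdsWithin hz)
  have h2 : HasDerivWithinAt (fun σ : ℝ => (σ, z.2)) (1, 0) A z.1 :=
    (hasDerivWithinAt_id z.1 A).prodMk (hasDerivWithinAt_const z.1 A z.2)
  exact h1.comp_hasDerivWithinAt z.1 h2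
    (show MapsTo (fun σ : ℝ => (σ, z.2)) A (A ×ˢ B) from fun σ hσ => ⟨hσ, (hQ.subset hz).2⟩)

theorem hasDerivWithinAt_slice_snd (hQ : IsRelOpen A B Q) (hz : z ∈ Q)
    (hf : DifferentiableWithinAt ℝ f Q z) :
    HasDerivWithinAt (fun τ => f (z.1, τ)) (fderivWithin ℝ f Q z (0, 1)) B z.2 := by
  have h1 : HasFDerivWithinAt f (fderivWithin ℝ f Q z) (A ×ˢ B) (z.1, z.2) :=
    hf.hasFDerivWithinAt.mono_of_mem_nhdsWithin (hQ.mem_nhdsWithin hz)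
  have h2 : HasDerivWithinAt (fun τ : ℝ => (z.1, τ)) (0, 1) B z.2 :=
    (hasDerivWithinAt_const z.2 B z.1).prodMk (hasDerivWithinAt_id z.2 B)
  exact h1.comp_hasDerivWithinAt z.2 h2
    (show MapsTo (fun τ : ℝ => (z.1, τ)) B (A ×ˢ B) from fun τ hτ => ⟨(hQ.subset hz).1, hτ⟩)

theorem partialFst_eq (hA : IsParamInterval A) (hQ : IsRelOpen A B Q) (hz : z ∈ Q)
    (hf : DifferentiableWithinAt ℝ f Q z) : partialFst A f z = fderivWithin ℝ f Q z (1, 0) :=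
  (hasDerivWithinAt_slice_fst hQ hz hf).derivWithin (hA.uniqueDiffOn _ (hQ.subset hz).1)

theorem partialSnd_eq (hB : IsParamInterval B) (hQ : IsRelOpen A B Q) (hz : z ∈ Q)
    (hf : DifferentiableWithinAt ℝ f Q z) : partialSnd B f z = fderivWithin ℝ f Q z (0, 1) :=
  (hasDerivWithinAt_slice_snd hQ hz hf).derivWithin (hB.uniqueDiffOn _ (hQ.subset hz).2)

theorem hasDerivWithinAt_partialFst (hA : IsParamInterval A) (hQ : IsRelOpen A B Q) (hz : z ∈ Q)
    (hf : DifferentiableWithinAt ℝ f Q z) :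
    HasDerivWithinAt (fun σ => f (σ, z.2)) (partialFst A f z) A z.1 :=
  partialFst_eq hA hQ hz hf ▸ hasDerivWithinAt_slice_fst hQ hz hf

theorem hasDerivWithinAt_partialSnd (hB : IsParamInterval B) (hQ : IsRelOpen A B Q) (hz : z ∈ Q)
    (hf : DifferentiableWithinAt ℝ f Q z) :
    HasDerivWithinAt (fun τ => f (z.1, τ)) (partialSnd B f z) B z.2 :=
  partialSnd_eq hB hQ hz hf ▸ hasDerivWithinAt_slice_snd hQ hz hf

theorem contDiffOn_partialFst (hA : IsParamInterval A) (hB : IsParamInterval B)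
    (hQ : IsRelOpen A B Q) (hf : ContDiffOn ℝ ∞ f Q) : ContDiffOn ℝ ∞ (partialFst A f) Q :=
  ((hf.fderivWithin (hQ.uniqueDiffOn hA hB) (m := ∞) le_rfl).clm_apply
    (contDiffOn_const (c := ((1, 0) : ℝ × ℝ)))).congr
      fun z hz => partialFst_eq hA hQ hz ((hf z hz).differentiableWithinAt (by simp))

theorem contDiffOn_partialSnd (hA : IsParamInterval A) (hB : IsParamInterval B)
    (hQ : IsRelOpen A B Q) (hf : ContDiffOn ℝ ∞ f Q) : ContDiffOn ℝ ∞ (partialSnd B f) Q :=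
  ((hf.fderivWithin (hQ.uniqueDiffOn hA hB) (m := ∞) le_rfl).clm_apply
    (contDiffOn_const (c := ((0, 1) : ℝ × ℝ)))).congr
      fun z hz => partialSnd_eq hB hQ hz ((hf z hz).differentiableWithinAt (by simp))

/-- Symmetry of second derivatives holds up to the boundary, since every point of `Q` is a limit of
interior points. -/
theorem partialFst_partialSnd_comm (hA : IsParamInterval A) (hB : IsParamInterval B)
    (hQ : IsRelOpen A B Q) (hf : ContDiffOn ℝ ∞ f Q) (hz : z ∈ Q) :
    partialFst A (partialSnd B f) z = partialSnd B (partialFst A f) z := by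
  have hu := hQ.uniqueDiffOn hA hB
  have hf' := hf.fderivWithin hu (m := ∞) le_rfl
  have hd : ∀ z ∈ Q, DifferentiableWithinAt ℝ f Q z := fun z hz =>
    (hf z hz).differentiableWithinAt (by simp)
  have hd' : HasFDerivWithinAt (fderivWithin ℝ f Q) _ Q z :=
    ((hf' z hz).differentiableWithinAt (by simp)).hasFDerivWithinAt
  rw [partialFst_eq hA hQ hz
      ((contDiffOn_partialSnd hA hB hQ hf z hz).differentiableWithinAt (by simp)),
    partialSnd_eq hB hQ hz
      ((contDiffOn_partialFst hA hB hQ hf z hz).differentiableWithinAt (by simp)),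
    fderivWithin_congr (fun w hw => partialSnd_eq hB hQ hw (hd w hw))
      (partialSnd_eq hB hQ hz (hd z hz)),
    fderivWithin_congr (fun w hw => partialFst_eq hA hQ hw (hd w hw))
      (partialFst_eq hA hQ hz (hd z hz)),
    (hd'.clm_apply (hasFDerivWithinAt_const (0, 1) z Q)).fderivWithin (hu z hz),
    (hd'.clm_apply (hasFDerivWithinAt_const (1, 0) z Q)).fderivWithin (hu z hz)]
  have := (hf z hz).isSymmSndFDerivWithinAt
    (by simpa using (ENat.LEInfty.out : (2 : ℕ∞ω) ≤ ∞)) hu (hQ.subset_closure hA hB hz) hz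
  simpa using this (1, 0) (0, 1)

end Slices

/-! ### Smooth vector fields along the parameter surface -/

section Surface

variable {n : ℕ} {M : Type*} [TopologicalSpace M] [ChartedSpace (EuclideanSpace ℝ (Fin n)) M]
  [IsManifold (𝓡 n) ∞ M]
  {A B : Set ℝ} {c : ℝ → ℝ → M}

/-- `c` is smooth on the rectangle `A ×ˢ B`. -/
def SmoothSurface (n : ℕ) {M : Type*} [TopologicalSpace M]
    [ChartedSpace (EuclideanSpace ℝ (Fin n)) M] (A B : Set ℝ) (c : ℝ → ℝ → M) : Prop :=
  ContMDiffOn 𝓘(ℝ, ℝ × ℝ) (𝓡 n) ∞ (fun q : ℝ × ℝ => c q.1 q.2) (A ×ˢ B)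

/-- The parameters in `A ×ˢ B` that `c` maps to the domain of the preferred chart at `p`. -/
def patch (n : ℕ) {M : Type*} [TopologicalSpace M]
    [ChartedSpace (EuclideanSpace ℝ (Fin n)) M] (A B : Set ℝ) (c : ℝ → ℝ → M) (p : M) :
    Set (ℝ × ℝ) :=
  A ×ˢ B ∩ {z | c z.1 z.2 ∈ (chartAt (EuclideanSpace ℝ (Fin n)) p).source}

/-- A smooth vector field along `c`: its components in all charts are smooth. -/
def SmoothField (A B : Set ℝ) (c : ℝ → ℝ → M) (V : ∀ s t, TangentSpace (𝓡 n) (c s t)) : Prop :=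
  ∀ p, ContDiffOn ℝ ∞ (fun z => chartVec p (c z.1 z.2) (V z.1 z.2)) (patch n A B c p)

theorem SmoothSurface.isRelOpen_patch (hc : SmoothSurface n A B c) (p : M) :
    IsRelOpen A B (patch n A B c p) := by
  obtain ⟨W, hW, h⟩ := continuousOn_iff'.1 (ContMDiffOn.continuousOn hc)
    (chartAt (EuclideanSpace ℝ (Fin n)) p).source (chartAt _ p).open_source
  refine ⟨W, hW, ?_⟩
  rw [inter_comm _ W, ← h, inter_comm]
  rfl

theorem SmoothSurface.contDiffOn_extChartAt (hc : SmoothSurface n A B c) (p : M) :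
    ContDiffOn ℝ ∞ (fun z : ℝ × ℝ => extChartAt (𝓡 n) p (c z.1 z.2)) (patch n A B c p) := by
  rw [← contMDiffOn_iff_contDiffOn]
  exact (contMDiffOn_extChartAt (n := ∞) (x := p)).comp (ContMDiffOn.mono hc inter_subset_left)
    fun z hz => hz.2

theorem mem_patch_self {s t : ℝ} (hs : s ∈ A) (ht : t ∈ B) :
    ((s, t) : ℝ × ℝ) ∈ patch n A B c (c s t) :=
  ⟨⟨hs, ht⟩, mem_chart_source _ _⟩

theorem SmoothSurface.mdifferentiableWithinAt_snd (hc : SmoothSurface n A B c) {s t : ℝ}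
    (hs : s ∈ A) (ht : t ∈ B) :
    MDifferentiableWithinAt 𝓘(ℝ, ℝ) (𝓡 n) (fun τ => c s τ) B t := by
  have h1 : MDifferentiableWithinAt 𝓘(ℝ, ℝ × ℝ) (𝓡 n) (fun q : ℝ × ℝ => c q.1 q.2) (A ×ˢ B)
    (s, t) := (hc (s, t) ⟨hs, ht⟩).mdifferentiableWithinAt (by simp)
  have h2 : MDifferentiableWithinAt 𝓘(ℝ, ℝ) 𝓘(ℝ, ℝ × ℝ) (fun τ : ℝ => (s, τ)) B t :=
    ((differentiableWithinAt_const s).prodMk differentiableWithinAt_id).mdifferentiableWithinAt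
  exact MDifferentiableWithinAt.comp (I' := 𝓘(ℝ, ℝ × ℝ)) (g := fun q : ℝ × ℝ => c q.1 q.2)
    (f := fun τ : ℝ => (s, τ)) t h1 h2 fun τ hτ => ⟨hs, hτ⟩

theorem SmoothSurface.mdifferentiableWithinAt_fst (hc : SmoothSurface n A B c) {s t : ℝ}
    (hs : s ∈ A) (ht : t ∈ B) :
    MDifferentiableWithinAt 𝓘(ℝ, ℝ) (𝓡 n) (fun σ => c σ t) A s := by
  have h1 : MDifferentiableWithinAt 𝓘(ℝ, ℝ × ℝ) (𝓡 n) (fun q : ℝ × ℝ => c q.1 q.2) (A ×ˢ B)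
    (s, t) := (hc (s, t) ⟨hs, ht⟩).mdifferentiableWithinAt (by simp)
  have h2 : MDifferentiableWithinAt 𝓘(ℝ, ℝ) 𝓘(ℝ, ℝ × ℝ) (fun σ : ℝ => (σ, t)) A s :=
    (differentiableWithinAt_id.prodMk (differentiableWithinAt_const t)).mdifferentiableWithinAt
  exact MDifferentiableWithinAt.comp (I' := 𝓘(ℝ, ℝ × ℝ)) (g := fun q : ℝ × ℝ => c q.1 q.2)
    (f := fun σ : ℝ => (σ, t)) s h1 h2 fun σ hσ => ⟨hσ, ht⟩

variable {V W : ∀ s t, TangentSpace (𝓡 n) (c s t)}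

theorem SmoothField.of_contMDiffOn
    (hV : ContMDiffOn 𝓘(ℝ, ℝ × ℝ) (𝓡 n).tangent ∞
      (fun q : ℝ × ℝ => (⟨c q.1 q.2, V q.1 q.2⟩ : TangentBundle (𝓡 n) M)) (A ×ˢ B)) :
    SmoothField A B c V := by
  intro p
  rw [← contMDiffOn_iff_contDiffOn]
  have h1 := (trivializationAt (EuclideanSpace ℝ (Fin n))
    (TangentSpace (𝓡 n) : M → Type _) p).contMDiffOn (IB := 𝓡 n) (n := ∞)
  have h2 := h1.comp (hV.mono (inter_subset_left (t := {z : ℝ × ℝ | c z.1 z.2 ∈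
    (chartAt (EuclideanSpace ℝ (Fin n)) p).source}))) (fun z hz => hz.2)
  exact contMDiff_snd.comp_contMDiffOn h2

theorem SmoothField.smul {f : ℝ → ℝ → ℝ}
    (hf : ContDiffOn ℝ ∞ (fun z : ℝ × ℝ => f z.1 z.2) (A ×ˢ B)) (hV : SmoothField A B c V) :
    SmoothField A B c (fun s t => f s t • V s t) := fun p => by
  simp only [chartVec_smul]
  exact (hf.mono inter_subset_left).smul (hV p)

theorem SmoothField.diffFieldAt_snd (hc : SmoothSurface n A B c) (hV : SmoothField A B c V)
    {s t : ℝ} (hs : s ∈ A) (ht : t ∈ B) : DiffFieldAt B (c s) (V s) t :=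
  (hasDerivWithinAt_slice_snd (hc.isRelOpen_patch (c s t)) (mem_patch_self hs ht)
    ((hV (c s t) _ (mem_patch_self hs ht)).differentiableWithinAt (by simp))).differentiableWithinAt

theorem SmoothField.diffFieldAt_fst (hc : SmoothSurface n A B c) (hV : SmoothField A B c V)
    {s t : ℝ} (hs : s ∈ A) (ht : t ∈ B) :
    DiffFieldAt A (fun σ => c σ t) (fun σ => V σ t) s :=
  (hasDerivWithinAt_slice_fst (hc.isRelOpen_patch (c s t)) (mem_patch_self hs ht)
    ((hV (c s t) _ (mem_patch_self hs ht)).differentiableWithinAt (by simp))).differentiableWithinAt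

theorem SmoothSurface.chartVec_velocity_snd (hc : SmoothSurface n A B c) (hB : IsParamInterval B)
    {p : M} {z : ℝ × ℝ} (hz : z ∈ patch n A B c p) :
    chartVec p (c z.1 z.2) (velocity B (c z.1) z.2) =
      partialSnd B (fun z : ℝ × ℝ => extChartAt (𝓡 n) p (c z.1 z.2)) z :=
  ((hasDerivWithinAt_extChartAt (hc.mdifferentiableWithinAt_snd hz.1.1 hz.1.2)
    hz.2).derivWithin (hB.uniqueDiffOn _ hz.1.2)).symm

theorem SmoothSurface.chartVec_velocity_fst (hc : SmoothSurface n A B c) (hA : IsParamInterval A)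
    {p : M} {z : ℝ × ℝ} (hz : z ∈ patch n A B c p) :
    chartVec p (c z.1 z.2) (velocity A (fun σ => c σ z.2) z.1) =
      partialFst A (fun z : ℝ × ℝ => extChartAt (𝓡 n) p (c z.1 z.2)) z :=
  ((hasDerivWithinAt_extChartAt (hc.mdifferentiableWithinAt_fst hz.1.1 hz.1.2)
    hz.2).derivWithin (hA.uniqueDiffOn _ hz.1.1)).symm

theorem SmoothSurface.smoothField_velocity_snd (hc : SmoothSurface n A B c)
    (hA : IsParamInterval A) (hB : IsParamInterval B) :
    SmoothField A B c (fun s t => velocity (n := n) B (c s) t) := fun p =>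
  (contDiffOn_partialSnd hA hB (hc.isRelOpen_patch p) (hc.contDiffOn_extChartAt p)).congr
    fun _ hz => hc.chartVec_velocity_snd hB hz

theorem SmoothSurface.smoothField_velocity_fst (hc : SmoothSurface n A B c)
    (hA : IsParamInterval A) (hB : IsParamInterval B) :
    SmoothField A B c (fun s t => velocity (n := n) A (fun σ => c σ t) s) := fun p =>
  (contDiffOn_partialFst hA hB (hc.isRelOpen_patch p) (hc.contDiffOn_extChartAt p)).congr
    fun _ hz => hc.chartVec_velocity_fst hA hz

variable [RiemannianBundle (fun x : M => TangentSpace (𝓡 n) x)]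
  [IsContMDiffRiemannianBundle (𝓡 n) ∞ (EuclideanSpace ℝ (Fin n))
      (fun x : M => TangentSpace (𝓡 n) x)]

/-- The covariant derivative in the second parameter. -/
def covSnd (B : Set ℝ) (c : ℝ → ℝ → M) (V : ∀ s t, TangentSpace (𝓡 n) (c s t)) (s t : ℝ) :
    TangentSpace (𝓡 n) (c s t) := covDeriv B (c s) (V s) t

/-- The covariant derivative in the first parameter. -/
def covFst (A : Set ℝ) (c : ℝ → ℝ → M) (V : ∀ s t, TangentSpace (𝓡 n) (c s t)) (s t : ℝ) :
    TangentSpace (𝓡 n) (c s t) := covDeriv A (fun σ => c σ t) (fun σ => V σ t) s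

theorem chartVec_covSnd (hc : SmoothSurface n A B c) (hB : IsParamInterval B)
    (hV : SmoothField A B c V) {p : M} {z : ℝ × ℝ} (hz : z ∈ patch n A B c p) :
    chartVec p (c z.1 z.2) (covSnd B c V z.1 z.2) =
      partialSnd B (fun z => chartVec p (c z.1 z.2) (V z.1 z.2)) z
      + christoffelForm p (extChartAt (𝓡 n) p (c z.1 z.2))
        (partialSnd B (fun z : ℝ × ℝ => extChartAt (𝓡 n) p (c z.1 z.2)) z)
        (chartVec p (c z.1 z.2) (V z.1 z.2)) := by
  rw [← hc.chartVec_velocity_snd hB hz]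
  exact chartVec_covDeriv (hB.uniqueDiffOn _ hz.1.2)
    (hc.mdifferentiableWithinAt_snd hz.1.1 hz.1.2) hz.2
    (hasDerivWithinAt_slice_snd (hc.isRelOpen_patch p) hz
      ((hV p z hz).differentiableWithinAt (by simp))).differentiableWithinAt

theorem chartVec_covFst (hc : SmoothSurface n A B c) (hA : IsParamInterval A)
    (hV : SmoothField A B c V) {p : M} {z : ℝ × ℝ} (hz : z ∈ patch n A B c p) :
    chartVec p (c z.1 z.2) (covFst A c V z.1 z.2) =
      partialFst A (fun z => chartVec p (c z.1 z.2) (V z.1 z.2)) z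
      + christoffelForm p (extChartAt (𝓡 n) p (c z.1 z.2))
        (partialFst A (fun z : ℝ × ℝ => extChartAt (𝓡 n) p (c z.1 z.2)) z)
        (chartVec p (c z.1 z.2) (V z.1 z.2)) := by
  rw [← hc.chartVec_velocity_fst hA hz]
  exact chartVec_covDeriv (γ := fun σ => c σ z.2) (V := fun σ => V σ z.2)
    (hA.uniqueDiffOn _ hz.1.1) (hc.mdifferentiableWithinAt_fst hz.1.1 hz.1.2) hz.2
    (hasDerivWithinAt_slice_fst (hc.isRelOpen_patch p) hz
      ((hV p z hz).differentiableWithinAt (by simp))).differentiableWithinAt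

theorem SmoothSurface.contDiffOn_christoffelForm (hc : SmoothSurface n A B c) (p : M) :
    ContDiffOn ℝ ∞ (fun z : ℝ × ℝ => christoffelForm p (extChartAt (𝓡 n) p (c z.1 z.2)))
      (patch n A B c p) :=
  ContDiffOn.comp (g := christoffelForm p) (CurveVariation.contDiffOn_christoffelForm p) (hc.contDiffOn_extChartAt p)
    fun z hz => (extChartAt (𝓡 n) p).map_source (by simpa using hz.2)

theorem SmoothField.covSnd (hc : SmoothSurface n A B c) (hA : IsParamInterval A)
    (hB : IsParamInterval B) (hV : SmoothField A B c V) : SmoothField A B c (covSnd B c V) :=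
  fun p => ((contDiffOn_partialSnd hA hB (hc.isRelOpen_patch p) (hV p)).add
    (((hc.contDiffOn_christoffelForm p).clm_apply (contDiffOn_partialSnd hA hB
      (hc.isRelOpen_patch p) (hc.contDiffOn_extChartAt p))).clm_apply (hV p))).congr
    fun _ hz => chartVec_covSnd hc hB hV hz

theorem SmoothField.covFst (hc : SmoothSurface n A B c) (hA : IsParamInterval A)
    (hB : IsParamInterval B) (hV : SmoothField A B c V) : SmoothField A B c (covFst A c V) :=
  fun p => ((contDiffOn_partialFst hA hB (hc.isRelOpen_patch p) (hV p)).add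
    (((hc.contDiffOn_christoffelForm p).clm_apply (contDiffOn_partialFst hA hB
      (hc.isRelOpen_patch p) (hc.contDiffOn_extChartAt p))).clm_apply (hV p))).congr
    fun _ hz => chartVec_covFst hc hA hV hz

theorem SmoothField.contDiffOn_inner (hc : SmoothSurface n A B c) (hV : SmoothField A B c V)
    (hW : SmoothField A B c W) :
    ContDiffOn ℝ ∞ (fun z : ℝ × ℝ => (inner ℝ (V z.1 z.2) (W z.1 z.2) : ℝ)) (A ×ˢ B) := by
  intro z hz
  set p := c z.1 z.2
  have hp : z ∈ patch n A B c p := mem_patch_self hz.1 hz.2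
  have hG : ContDiffOn ℝ ∞ (fun z : ℝ × ℝ => metricForm p (extChartAt (𝓡 n) p (c z.1 z.2)))
      (patch n A B c p) :=
    ContDiffOn.comp (g := metricForm p) (contDiffOn_metricForm p) (hc.contDiffOn_extChartAt p)
      fun z hz => (extChartAt (𝓡 n) p).map_source (by simpa using hz.2)
  refine ContDiffWithinAt.mono_of_mem_nhdsWithin ?_ ((hc.isRelOpen_patch p).mem_nhdsWithin hp)
  exact (((hG.clm_apply (hV p)).clm_apply (hW p)).congr
    fun w hw => (metricForm_chartVec hw.2 _ _).symm) z hp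

/-- The Levi-Civita connection is torsion free. -/
theorem covFst_velocity_snd (hc : SmoothSurface n A B c) (hA : IsParamInterval A)
    (hB : IsParamInterval B) {s t : ℝ} (hs : s ∈ A) (ht : t ∈ B) :
    covFst A c (fun s t => velocity (n := n) B (c s) t) s t =
      covSnd B c (fun s t => velocity (n := n) A (fun σ => c σ t) s) s t := by
  have hz := mem_patch_self (n := n) (c := c) hs ht
  apply chartVec_injective hz.2
  have h1 := chartVec_covFst hc hA (hc.smoothField_velocity_snd hA hB) hz
  have h2 := chartVec_covSnd hc hB (hc.smoothField_velocity_fst hA hB) hz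
  refine h1.trans (Eq.trans ?_ h2.symm)
  rw [hc.chartVec_velocity_snd hB hz, hc.chartVec_velocity_fst hA hz,
    christoffelForm_symm ((extChartAt (𝓡 n) (c s t)).map_source (by simp))]
  congr 1
  -- The velocity components equal the partial derivatives of the coordinates on the whole patch, so
  -- the equality may be differentiated. With `e2` the claim is reduced to equality of mixed partial
  -- derivatives.
  have e1 : partialFst A (fun z => chartVec (c s t) (c z.1 z.2) (velocity B (c z.1) z.2)) (s, t) =
      partialFst A (partialSnd B fun z : ℝ × ℝ => extChartAt (𝓡 n) (c s t) (c z.1 z.2)) (s, t) := by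
    have hsm := contDiffOn_partialSnd hA hB (hc.isRelOpen_patch _)
      (hc.contDiffOn_extChartAt (c s t))
    rw [partialFst_eq hA (hc.isRelOpen_patch _) hz ((hsm _ hz).differentiableWithinAt (by simp)),
      partialFst_eq hA (hc.isRelOpen_patch _) hz
        ((hc.smoothField_velocity_snd hA hB _ _ hz).differentiableWithinAt (by simp))]
    congr 1
    exact fderivWithin_congr (fun w hw => hc.chartVec_velocity_snd hB hw)
      (hc.chartVec_velocity_snd hB hz)
  have e2 : partialSnd B (fun z => chartVec (c s t) (c z.1 z.2)
        (velocity A (fun σ => c σ z.2) z.1)) (s, t) =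
      partialSnd B (partialFst A fun z : ℝ × ℝ => extChartAt (𝓡 n) (c s t) (c z.1 z.2)) (s, t) := by
    have hsm := contDiffOn_partialFst hA hB (hc.isRelOpen_patch _)
      (hc.contDiffOn_extChartAt (c s t))
    rw [partialSnd_eq hB (hc.isRelOpen_patch _) hz ((hsm _ hz).differentiableWithinAt (by simp)),
      partialSnd_eq hB (hc.isRelOpen_patch _) hz
        ((hc.smoothField_velocity_fst hA hB _ _ hz).differentiableWithinAt (by simp))]
    congr 1
    exact fderivWithin_congr (fun w hw => hc.chartVec_velocity_fst hA hw)
      (hc.chartVec_velocity_fst hA hz)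
  rw [e1, e2, partialFst_partialSnd_comm hA hB (hc.isRelOpen_patch _)
    (hc.contDiffOn_extChartAt _) hz]

end Surface

/-! ### Commutator of covariant partial derivatives in coordinates -/

section PartialCongr

variable {A B : Set ℝ} {F : Type*} [NormedAddCommGroup F] [NormedSpace ℝ F]
  {f g : ℝ × ℝ → F} {z : ℝ × ℝ} {Q : Set (ℝ × ℝ)}

theorem partialFst_congr (hQ : IsRelOpen A B Q) (hz : z ∈ Q) (h : ∀ w ∈ Q, f w = g w) :
    partialFst A f z = partialFst A g z := by
  have hcont : ContinuousWithinAt (fun σ : ℝ => (σ, z.2)) A z.1 :=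
    (continuousWithinAt_id.prodMk continuousWithinAt_const)
  have hev : ∀ᶠ σ in nhdsWithin z.1 A, (σ, z.2) ∈ Q :=
    (hcont.tendsto_nhdsWithin (t := A ×ˢ B) fun σ hσ => ⟨hσ, (hQ.subset hz).2⟩).eventually
      (hQ.mem_nhdsWithin hz)
  refine Filter.EventuallyEq.derivWithin_eq ?_ (h _ hz)
  filter_upwards [hev] with σ hσ
  exact h _ hσ

theorem partialSnd_congr (hQ : IsRelOpen A B Q) (hz : z ∈ Q) (h : ∀ w ∈ Q, f w = g w) :
    partialSnd B f z = partialSnd B g z := by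
  have hcont : ContinuousWithinAt (fun τ : ℝ => (z.1, τ)) B z.2 :=
    (continuousWithinAt_const.prodMk continuousWithinAt_id)
  have hev : ∀ᶠ τ in nhdsWithin z.2 B, (z.1, τ) ∈ Q :=
    (hcont.tendsto_nhdsWithin (t := A ×ˢ B) fun σ hσ => ⟨(hQ.subset hz).1, hσ⟩).eventually
      (hQ.mem_nhdsWithin hz)
  refine Filter.EventuallyEq.derivWithin_eq ?_ (h _ hz)
  filter_upwards [hev] with σ hσ
  exact h _ hσ

variable {E : Type*} [NormedAddCommGroup E] [NormedSpace ℝ E] {Γ : E → E →L[ℝ] E →L[ℝ] E}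
  {X v : ℝ × ℝ → E}

theorem partialFst_connection (hA : IsParamInterval A) (hB : IsParamInterval B)
    (hQ : IsRelOpen A B Q) (hz : z ∈ Q) (hΓ : DifferentiableAt ℝ Γ (X z))
    (hX : ContDiffOn ℝ ∞ X Q) (hv : ContDiffOn ℝ ∞ v Q) :
    partialFst A (fun w => partialSnd B v w + Γ (X w) (partialSnd B X w) (v w)) z =
      partialFst A (partialSnd B v) z
        + ((fderiv ℝ Γ (X z) (partialFst A X z) (partialSnd B X z)
            + Γ (X z) (partialFst A (partialSnd B X) z)) (v z)
          + Γ (X z) (partialSnd B X z) (partialFst A v z)) := by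
  have d : ∀ {f : ℝ × ℝ → E}, ContDiffOn ℝ ∞ f Q → HasDerivWithinAt (fun σ => f (σ, z.2))
      (partialFst A f z) A z.1 := fun hf =>
    hasDerivWithinAt_partialFst hA hQ hz ((hf z hz).differentiableWithinAt (by simp))
  have h1 : HasDerivWithinAt (fun σ => Γ (X (σ, z.2))) (fderiv ℝ Γ (X z) (partialFst A X z))
      A z.1 :=
    HasFDerivAt.comp_hasDerivWithinAt (l := Γ) (f := fun σ => X (σ, z.2)) z.1
      hΓ.hasFDerivAt (d hX)
  have h2 := h1.clm_apply (d (contDiffOn_partialSnd hA hB hQ hX))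
  exact ((d (contDiffOn_partialSnd hA hB hQ hv)).add (h2.clm_apply (d hv))).derivWithin
    (hA.uniqueDiffOn _ (hQ.subset hz).1)

theorem partialSnd_connection (hA : IsParamInterval A) (hB : IsParamInterval B)
    (hQ : IsRelOpen A B Q) (hz : z ∈ Q) (hΓ : DifferentiableAt ℝ Γ (X z))
    (hX : ContDiffOn ℝ ∞ X Q) (hv : ContDiffOn ℝ ∞ v Q) :
    partialSnd B (fun w => partialFst A v w + Γ (X w) (partialFst A X w) (v w)) z =
      partialSnd B (partialFst A v) z
        + ((fderiv ℝ Γ (X z) (partialSnd B X z) (partialFst A X z)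
            + Γ (X z) (partialSnd B (partialFst A X) z)) (v z)
          + Γ (X z) (partialFst A X z) (partialSnd B v z)) := by
  have d : ∀ {f : ℝ × ℝ → E}, ContDiffOn ℝ ∞ f Q → HasDerivWithinAt (fun τ => f (z.1, τ))
      (partialSnd B f z) B z.2 := fun hf =>
    hasDerivWithinAt_partialSnd hB hQ hz ((hf z hz).differentiableWithinAt (by simp))
  have h1 : HasDerivWithinAt (fun τ => Γ (X (z.1, τ))) (fderiv ℝ Γ (X z) (partialSnd B X z))
      B z.2 :=
    HasFDerivAt.comp_hasDerivWithinAt (l := Γ) (f := fun τ => X (z.1, τ)) z.2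
      hΓ.hasFDerivAt (d hX)
  have h2 := h1.clm_apply (d (contDiffOn_partialFst hA hB hQ hX))
  exact ((d (contDiffOn_partialFst hA hB hQ hv)).add (h2.clm_apply (d hv))).derivWithin
    (hB.uniqueDiffOn _ (hQ.subset hz).2)

/-- The curvature of a connection is the commutator of the covariant partial derivatives. -/
theorem partialFst_partialSnd_commutator (hA : IsParamInterval A) (hB : IsParamInterval B)
    (hQ : IsRelOpen A B Q) (hz : z ∈ Q) (hΓ : DifferentiableAt ℝ Γ (X z))
    (hX : ContDiffOn ℝ ∞ X Q) (hv : ContDiffOn ℝ ∞ v Q) :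
    partialFst A (fun w => partialSnd B v w + Γ (X w) (partialSnd B X w) (v w)) z
        + Γ (X z) (partialFst A X z) (partialSnd B v z + Γ (X z) (partialSnd B X z) (v z)) =
      partialSnd B (fun w => partialFst A v w + Γ (X w) (partialFst A X w) (v w)) z
        + Γ (X z) (partialSnd B X z) (partialFst A v z + Γ (X z) (partialFst A X z) (v z))
        + localCurvature Γ (X z) (partialFst A X z) (partialSnd B X z) (v z) := by
  rw [partialFst_connection hA hB hQ hz hΓ hX hv, partialSnd_connection hA hB hQ hz hΓ hX hv,
    partialFst_partialSnd_comm hA hB hQ hX hz, partialFst_partialSnd_comm hA hB hQ hv hz,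
    localCurvature]
  simp only [add_apply, ContinuousLinearMap.map_add]
  abel

end PartialCongr

/-! ### Algebraic symmetries of the curvature and sectional curvature -/

section Curvature

variable {n : ℕ} {M : Type*} [TopologicalSpace M] [ChartedSpace (EuclideanSpace ℝ (Fin n)) M]
  [IsManifold (𝓡 n) ∞ M] [RiemannianBundle (fun x : M => TangentSpace (𝓡 n) x)]
  [IsContMDiffRiemannianBundle (𝓡 n) ∞ (EuclideanSpace ℝ (Fin n))
      (fun x : M => TangentSpace (𝓡 n) x)]

theorem chartVec_riemannCurvature (p : M) (u v w : TangentSpace (𝓡 n) p) :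
    chartVec p p (riemannCurvature p u v w) = localCurvature (christoffelForm p)
      (extChartAt (𝓡 n) p p) (chartVec p p u) (chartVec p p v) (chartVec p p w) := by
  rw [chartVec_self, chartVec_self, chartVec_self, chartVec_self]
  exact riemannCurvature_eq p u v w

theorem riemannCurvature_swap (p : M) (u v w : TangentSpace (𝓡 n) p) :
    riemannCurvature p v u w = -riemannCurvature p u v w := by
  apply chartVec_injective (mem_chart_source (EuclideanSpace ℝ (Fin n)) p)
  rw [← neg_one_smul ℝ (riemannCurvature p u v w), chartVec_smul, chartVec_riemannCurvature,
    chartVec_riemannCurvature, localCurvature_swap, neg_one_smul]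

theorem riemannCurvature_add_left (p : M) (u u' v w : TangentSpace (𝓡 n) p) :
    riemannCurvature p (u + u') v w = riemannCurvature p u v w + riemannCurvature p u' v w := by
  apply chartVec_injective (mem_chart_source (EuclideanSpace ℝ (Fin n)) p)
  rw [chartVec_add, chartVec_riemannCurvature, chartVec_riemannCurvature,
    chartVec_riemannCurvature, chartVec_add, localCurvature_add_left]

theorem riemannCurvature_smul_left (p : M) (a : ℝ) (u v w : TangentSpace (𝓡 n) p) :
    riemannCurvature p (a • u) v w = a • riemannCurvature p u v w := by
  apply chartVec_injective (mem_chart_source (EuclideanSpace ℝ (Fin n)) p)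
  rw [chartVec_smul, chartVec_riemannCurvature, chartVec_riemannCurvature, chartVec_smul,
    localCurvature_smul_left]

theorem riemannCurvature_smul_right (p : M) (a : ℝ) (u v w : TangentSpace (𝓡 n) p) :
    riemannCurvature p u (a • v) w = a • riemannCurvature p u v w := by
  rw [riemannCurvature_swap, riemannCurvature_smul_left, riemannCurvature_swap, smul_neg, neg_neg]

theorem riemannCurvature_self (p : M) (u w : TangentSpace (𝓡 n) p) :
    riemannCurvature p u u w = 0 := by
  have h := riemannCurvature_swap p u u w
  have h2 : (2 : ℝ) • riemannCurvature p u u w = 0 := by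
    rw [two_smul]
    nth_rw 1 [h]
    exact neg_add_cancel _
  exact (smul_eq_zero.1 h2).resolve_left two_ne_zero

theorem inner_riemannCurvature_pair_symm (p : M) (u v w x : TangentSpace (𝓡 n) p) :
    (inner ℝ (riemannCurvature p u v w) x : ℝ) = inner ℝ (riemannCurvature p w x u) v := by
  have hp := mem_chart_source (EuclideanSpace ℝ (Fin n)) p
  have hy := mem_extChartAt_target (I := 𝓡 n) p
  have hev := (isOpen_extChartAt_target (I := 𝓡 n) p).mem_nhds hy
  rw [← metricForm_chartVec hp, ← metricForm_chartVec hp, chartVec_riemannCurvature,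
    chartVec_riemannCurvature]
  refine localCurvature_pair_symm ((contDiffAt_metricForm hy).of_le ENat.LEInfty.out)
    ((contDiffAt_christoffelForm hy).differentiableAt (by simp)) (metricForm_symm p _) ?_ ?_ _ _ _ _
  · filter_upwards [hev] with z hz
    exact metricForm_compatible hz
  · filter_upwards [hev] with z hz
    exact christoffelForm_symm hz

/-- When the curvature term is determined by the sectional curvature of the plane of `T` and `N`. -/
theorem inner_riemannCurvature_eq_sectionalCurvature (p : M) (u T N : TangentSpace (𝓡 n) p)
    (hT : (inner ℝ T T : ℝ) = 1) (hN : (inner ℝ N N : ℝ) = 1) (hNT : (inner ℝ N T : ℝ) = 0)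
    (h : n = 2 ∨ u ∈ Submodule.span ℝ {T, N} ∨ HasIsotropicCurvatureAt n p) :
    (inner ℝ (riemannCurvature p u T T) N : ℝ) = sectionalCurvature p N T * inner ℝ u N := by
  have hTN : (inner ℝ T N : ℝ) = 0 := by rw [real_inner_comm]; exact hNT
  have hK : sectionalCurvature p N T = inner ℝ (riemannCurvature p N T T) N := by
    rw [sectionalCurvature, hT, hN, hNT]
    norm_num
  have hspan : u ∈ Submodule.span ℝ {T, N} →
      (inner ℝ (riemannCurvature p u T T) N : ℝ) = sectionalCurvature p N T * inner ℝ u N := by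
    intro hu
    obtain ⟨a, b, rfl⟩ := Submodule.mem_span_pair.1 hu
    rw [riemannCurvature_add_left, riemannCurvature_smul_left, riemannCurvature_smul_left,
      riemannCurvature_self, hK, inner_add_left, inner_add_left, real_inner_smul_left,
      real_inner_smul_left, real_inner_smul_left, real_inner_smul_left, hN, hTN, inner_zero_left]
    ring
  have hind : ∀ a b : ℝ, a • T + b • N = 0 → a = 0 ∧ b = 0 := by
    intro a b hab
    have h1 := congrArg (fun w => (inner ℝ w T : ℝ)) hab
    have h2 := congrArg (fun w => (inner ℝ w N : ℝ)) hab
    simp only [inner_add_left, real_inner_smul_left, hT, hN, hNT, hTN, inner_zero_left] at h1 h2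
    constructor <;> linarith
  rcases h with rfl | h | ⟨k, hk⟩
  -- In dimension two the independent pair `T`, `N` spans the tangent space.
  · apply hspan
    have hli : LinearIndependent ℝ ![T, N] := LinearIndependent.pair_iff.2 hind
    have : FiniteDimensional ℝ (TangentSpace (𝓡 2) p) :=
      inferInstanceAs (FiniteDimensional ℝ (EuclideanSpace ℝ (Fin 2)))
    have hfin : Module.finrank ℝ (TangentSpace (𝓡 2) p) = 2 :=
      finrank_euclideanSpace_fin (𝕜 := ℝ) (n := 2)
    have := hli.span_eq_top_of_card_eq_finrank' (by rw [hfin]; rfl)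
    rw [Matrix.range_cons, Matrix.range_cons, Matrix.range_empty, union_empty] at this
    change u ∈ Submodule.span ℝ ({T} ∪ {N})
    rw [this]
    trivial
  · exact hspan h
  -- The Jacobi form is determined on the diagonal: by the common curvature `k` if `v` and `T` are
  -- independent, and with both sides zero otherwise. Polarising at `u + N`, `u` and `N` gives its
  -- value off the diagonal.
  · have hf : ∀ v : TangentSpace (𝓡 n) p, (inner ℝ (riemannCurvature p v T T) v : ℝ) =
        k * (inner ℝ v v - inner ℝ v T ^ 2) := by
      intro v
      by_cases hv : LinearIndependent ℝ ![v, T]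
      · have hd : (inner ℝ v v - inner ℝ v T ^ 2 : ℝ) ≠ 0 := by
          intro h0
          have h1 : v - (inner ℝ v T : ℝ) • T = 0 := by
            rw [← inner_self_eq_zero (𝕜 := ℝ)]
            simp only [inner_sub_left, inner_sub_right, real_inner_smul_left,
              real_inner_smul_right, hT, real_inner_comm v T]
            linarith
          have h2 := LinearIndependent.pair_iff.1 hv 1 (-(inner ℝ v T : ℝ))
            (by rw [one_smul, neg_smul, ← sub_eq_add_neg]; exact h1)
          exact one_ne_zero h2.1
        have := hk v T hv
        rw [sectionalCurvature, hT, mul_one] at this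
        rwa [div_eq_iff hd] at this
      · have hv' : ∃ a : ℝ, v = a • T := by
          by_contra hne
          apply hv
          rw [LinearIndependent.pair_iff]
          intro a b hab
          have ha : a = 0 := by
            by_contra ha
            apply hne
            refine ⟨-(a⁻¹ * b), ?_⟩
            have := congrArg (fun w => a⁻¹ • w) hab
            simp only [smul_add, smul_smul, inv_mul_cancel₀ ha, one_smul, smul_zero] at this
            rw [neg_smul]
            exact eq_neg_of_add_eq_zero_left this
          refine ⟨ha, ?_⟩
          rw [ha, zero_smul, zero_add] at hab
          refine (hind b 0 ?_).1
          rw [hab, zero_smul, zero_add]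
        obtain ⟨a, rfl⟩ := hv'
        rw [riemannCurvature_smul_left, riemannCurvature_self]
        simp only [smul_zero, inner_zero_left, real_inner_smul_left, real_inner_smul_right, hT]
        ring
    have h1 := hf (u + N)
    have h2 := hf u
    have h3 := hf N
    -- Symmetry of the Jacobi operator, from the pair symmetry; it merges the two mixed terms of the
    -- polarisation.
    have h5 : (inner ℝ (riemannCurvature p N T T) u : ℝ) =
        inner ℝ (riemannCurvature p u T T) N := by
      rw [inner_riemannCurvature_pair_symm p N T T u, riemannCurvature_swap, inner_neg_left,
        inner_riemannCurvature_pair_symm p u T N T, riemannCurvature_swap, inner_neg_left, neg_neg,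
        inner_riemannCurvature_pair_symm p T N u T]
    simp only [riemannCurvature_add_left, inner_add_left, inner_add_right, hN, hNT, h5,
      real_inner_comm u N] at h1
    rw [hN, hNT] at h3
    rw [hK, h3]
    nlinarith

end Curvature

/-! ### Curvature as the commutator of covariant derivatives -/

section Commutator

variable {n : ℕ} {M : Type*} [TopologicalSpace M] [ChartedSpace (EuclideanSpace ℝ (Fin n)) M]
  [IsManifold (𝓡 n) ∞ M] [RiemannianBundle (fun x : M => TangentSpace (𝓡 n) x)]
  [IsContMDiffRiemannianBundle (𝓡 n) ∞ (EuclideanSpace ℝ (Fin n))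
      (fun x : M => TangentSpace (𝓡 n) x)]
  {A B : Set ℝ} {c : ℝ → ℝ → M} {V : ∀ s t, TangentSpace (𝓡 n) (c s t)}

/-- The commutator of the covariant derivatives is the curvature. -/
theorem covFst_covSnd (hc : SmoothSurface n A B c) (hA : IsParamInterval A)
    (hB : IsParamInterval B) (hV : SmoothField A B c V) {s t : ℝ} (hs : s ∈ A) (ht : t ∈ B) :
    covFst A c (covSnd B c V) s t = covSnd B c (covFst A c V) s t
      + riemannCurvature (c s t) (velocity A (fun σ => c σ t) s) (velocity B (c s) t) (V s t) := by
  have hz := mem_patch_self (n := n) (c := c) hs ht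
  apply chartVec_injective hz.2
  have h1 := chartVec_covFst hc hA (hV.covSnd hc hA hB) hz
  have h2 := chartVec_covSnd hc hB (hV.covFst hc hA hB) hz
  rw [chartVec_add, chartVec_riemannCurvature]
  have e1 := hc.chartVec_velocity_snd hB hz
  have e2 := hc.chartVec_velocity_fst hA hz
  have f1 := chartVec_covSnd hc hB hV hz
  have f2 := chartVec_covFst hc hA hV hz
  simp only at h1 h2 e1 e2 f1 f2
  rw [h1, h2, e1, e2, f1, f2]
  have hQ := hc.isRelOpen_patch (c s t)
  -- The coordinate expressions of the inner covariant derivatives hold on the whole patch, so they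
  -- can be inserted under the outer partial derivatives.
  rw [partialFst_congr hQ hz (fun w hw => chartVec_covSnd hc hB hV hw),
    partialSnd_congr hQ hz (fun w hw => chartVec_covFst hc hA hV hw)]
  have hy : extChartAt (𝓡 n) (c s t) (c s t) ∈ (extChartAt (𝓡 n) (c s t)).target :=
    mem_extChartAt_target (c s t)
  exact partialFst_partialSnd_commutator hA hB hQ hz
    ((contDiffAt_christoffelForm hy).differentiableAt (by simp))
    (hc.contDiffOn_extChartAt (c s t)) (hV (c s t))

end Commutator

/-! ### First variation of the line element and of the curvature -/

section FirstVariation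

variable {n : ℕ} {M : Type*} [TopologicalSpace M] [ChartedSpace (EuclideanSpace ℝ (Fin n)) M]
  [IsManifold (𝓡 n) ∞ M] [RiemannianBundle (fun x : M => TangentSpace (𝓡 n) x)]
  {A B : Set ℝ} {c : ℝ → ℝ → M}

/-- The curves `c s` are immersed. -/
def ImmersedCurves (n : ℕ) {M : Type*} [TopologicalSpace M]
    [ChartedSpace (EuclideanSpace ℝ (Fin n)) M] (A B : Set ℝ) (c : ℝ → ℝ → M) : Prop :=
  ∀ s ∈ A, ∀ t ∈ B, velocity (n := n) B (c s) t ≠ 0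

theorem ImmersedCurves.inner_velocity_pos (hi : ImmersedCurves n A B c) {s t : ℝ} (hs : s ∈ A)
    (ht : t ∈ B) : (0 : ℝ) < inner ℝ (velocity (n := n) B (c s) t) (velocity B (c s) t) :=
  real_inner_self_pos.2 (hi s hs t ht)

theorem ImmersedCurves.lineElement_pos (hi : ImmersedCurves n A B c) {s t : ℝ} (hs : s ∈ A)
    (ht : t ∈ B) : 0 < lineElement (n := n) B (c s) t :=
  Real.sqrt_pos.2 (hi.inner_velocity_pos hs ht)

theorem ImmersedCurves.velocity_eq (hi : ImmersedCurves n A B c) {s t : ℝ} (hs : s ∈ A)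
    (ht : t ∈ B) :
    velocity (n := n) B (c s) t = lineElement (n := n) B (c s) t • unitTangent B (c s) t := by
  rw [unitTangent, smul_smul, mul_inv_cancel₀ (hi.lineElement_pos hs ht).ne', one_smul]

theorem ImmersedCurves.inner_unitTangent (hi : ImmersedCurves n A B c) {s t : ℝ} (hs : s ∈ A)
    (ht : t ∈ B) :
    (inner ℝ (unitTangent (n := n) B (c s) t) (unitTangent B (c s) t) : ℝ) = 1 := by
  have h := hi.lineElement_pos hs ht
  have h2 : lineElement (n := n) B (c s) t * lineElement (n := n) B (c s) t =
      inner ℝ (velocity (n := n) B (c s) t) (velocity B (c s) t) :=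
    Real.mul_self_sqrt (hi.inner_velocity_pos hs ht).le
  rw [unitTangent, real_inner_smul_left, real_inner_smul_right, ← h2]
  field_simp

variable [IsContMDiffRiemannianBundle (𝓡 n) ∞ (EuclideanSpace ℝ (Fin n))
      (fun x : M => TangentSpace (𝓡 n) x)]

theorem SmoothSurface.contDiffOn_lineElement (hc : SmoothSurface n A B c)
    (hA : IsParamInterval A) (hB : IsParamInterval B) (hi : ImmersedCurves n A B c) :
    ContDiffOn ℝ ∞ (fun z : ℝ × ℝ => lineElement (n := n) B (c z.1) z.2) (A ×ˢ B) :=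
  ((hc.smoothField_velocity_snd hA hB).contDiffOn_inner hc
    (hc.smoothField_velocity_snd hA hB)).sqrt
    fun _ hz => (hi.inner_velocity_pos hz.1 hz.2).ne'

theorem SmoothSurface.contDiffOn_inv_lineElement (hc : SmoothSurface n A B c)
    (hA : IsParamInterval A) (hB : IsParamInterval B) (hi : ImmersedCurves n A B c) :
    ContDiffOn ℝ ∞ (fun z : ℝ × ℝ => (lineElement (n := n) B (c z.1) z.2)⁻¹) (A ×ˢ B) :=
  (hc.contDiffOn_lineElement hA hB hi).inv fun _ hz => (hi.lineElement_pos hz.1 hz.2).ne'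

theorem SmoothSurface.smoothField_unitTangent (hc : SmoothSurface n A B c)
    (hA : IsParamInterval A) (hB : IsParamInterval B) (hi : ImmersedCurves n A B c) :
    SmoothField A B c (fun s t => unitTangent (n := n) B (c s) t) :=
  (hc.smoothField_velocity_snd hA hB).smul (hc.contDiffOn_inv_lineElement hA hB hi)

theorem SmoothField.covDerivT {V : ∀ s t, TangentSpace (𝓡 n) (c s t)} (hc : SmoothSurface n A B c)
    (hA : IsParamInterval A) (hB : IsParamInterval B) (hi : ImmersedCurves n A B c)
    (hV : SmoothField A B c V) : SmoothField A B c (fun s t => covDerivT B (c s) (V s) t) :=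
  (hV.covSnd hc hA hB).smul (hc.contDiffOn_inv_lineElement hA hB hi)

/-- Differentiate the square root of $g(\dot c,\dot c)$ by metricity and replace $\nabla_s\dot c$ by
$\nabla_tc'$ by vanishing torsion. -/
theorem hasDerivWithinAt_lineElement (hc : SmoothSurface n A B c)
    (hA : IsParamInterval A) (hB : IsParamInterval B) (hi : ImmersedCurves n A B c)
    {s t : ℝ} (hs : s ∈ A) (ht : t ∈ B) :
    HasDerivWithinAt (fun σ => lineElement (n := n) B (c σ) t)
      (inner ℝ (covDerivT (n := n) B (c s) (fun t => velocity (n := n) A (fun σ => c σ t) s) t)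
          (unitTangent B (c s) t) * lineElement (n := n) B (c s) t) A s := by
  have hv := (hc.smoothField_velocity_snd hA hB).diffFieldAt_fst hc hs ht
  have h1 := (hasDerivWithinAt_inner (hA.uniqueDiffOn s hs)
    (hc.mdifferentiableWithinAt_fst hs ht) hv hv).sqrt (hi.inner_velocity_pos hs ht).ne'
  refine h1.congr_deriv ?_
  have h2 := covFst_velocity_snd hc hA hB hs ht
  change covDeriv A (fun σ => c σ t) (fun σ => velocity (n := n) B (c σ) t) s =
    covDeriv B (c s) (fun t => velocity (n := n) A (fun σ => c σ t) s) t at h2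
  have hω := hi.lineElement_pos hs ht
  change _ / (2 * lineElement (n := n) B (c s) t) = _
  rw [h2, covDerivT, unitTangent, real_inner_smul_left, real_inner_smul_right,
    real_inner_comm (covDeriv B (c s) (fun t => velocity (n := n) A (fun σ => c σ t) s) t)]
  field_simp
  ring

theorem hasDerivWithinAt_inv_lineElement (hc : SmoothSurface n A B c)
    (hA : IsParamInterval A) (hB : IsParamInterval B) (hi : ImmersedCurves n A B c)
    {s t : ℝ} (hs : s ∈ A) (ht : t ∈ B) :
    HasDerivWithinAt (fun σ => (lineElement (n := n) B (c σ) t)⁻¹)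
      (-(inner ℝ (covDerivT (n := n) B (c s) (fun t => velocity (n := n) A (fun σ => c σ t) s) t)
          (unitTangent B (c s) t)) * (lineElement (n := n) B (c s) t)⁻¹) A s := by
  have hω := (hi.lineElement_pos hs ht).ne'
  refine ((hasDerivWithinAt_lineElement hc hA hB hi hs ht).fun_inv hω).congr_deriv ?_
  field_simp

/-- The covariant derivative of the unit tangent in the direction of the path parameter. -/
theorem covFst_unitTangent (hc : SmoothSurface n A B c)
    (hA : IsParamInterval A) (hB : IsParamInterval B) (hi : ImmersedCurves n A B c)
    {s t : ℝ} (hs : s ∈ A) (ht : t ∈ B) :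
    covFst A c (fun s t => unitTangent (n := n) B (c s) t) s t =
      covDerivT (n := n) B (c s) (fun t => velocity (n := n) A (fun σ => c σ t) s) t
      + (-(inner ℝ (covDerivT (n := n) B (c s)
            (fun t => velocity (n := n) A (fun σ => c σ t) s) t)
          (unitTangent B (c s) t) : ℝ)) • unitTangent B (c s) t := by
  have h1 := covDeriv_smul (hasDerivWithinAt_inv_lineElement hc hA hB hi hs ht)
    (hA.uniqueDiffOn s hs) ((hc.smoothField_velocity_snd hA hB).diffFieldAt_fst hc hs ht)
  refine h1.trans ?_
  have h2 := covFst_velocity_snd hc hA hB hs ht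
  change covDeriv A (fun σ => c σ t) (fun σ => velocity (n := n) B (c σ) t) s =
    covDeriv B (c s) (fun t => velocity (n := n) A (fun σ => c σ t) s) t at h2
  rw [h2, add_comm, mul_smul]
  rfl

variable {N : ∀ s t, TangentSpace (𝓡 n) (c s t)} {κ : ℝ → ℝ → ℝ}

/-- Write $\kappa=g(\nabla_TT,N)$ and differentiate by metricity. One $-\alpha\kappa$ comes from the
factor $\omega^{-1}$ in $\nabla_T$, the other from the correction $-\alpha T$ in $\nabla_sT$;
together they give the coefficient 2. -/
theorem hasDerivWithinAt_curvature (hc : SmoothSurface n A B c)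
    (hA : IsParamInterval A) (hB : IsParamInterval B) (hi : ImmersedCurves n A B c)
    (hN : SmoothField A B c N)
    (hunit : ∀ s ∈ A, ∀ t ∈ B, inner ℝ (N s t) (N s t) = (1 : ℝ))
    (hnormal : ∀ s ∈ A, ∀ t ∈ B, inner ℝ (N s t) (unitTangent B (c s) t) = (0 : ℝ))
    (hκ : ∀ s ∈ A, ∀ t ∈ B, covDerivT B (c s) (unitTangent B (c s)) t = κ s t • N s t)
    {s t : ℝ} (hs : s ∈ A) (ht : t ∈ B) :
    HasDerivWithinAt (fun σ => κ σ t)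
      (inner ℝ (covDerivT (n := n) B (c s) (covDerivT B (c s)
          (fun t => velocity (n := n) A (fun σ => c σ t) s)) t) (N s t)
        - 2 * κ s t * inner ℝ (covDerivT (n := n) B (c s)
            (fun t => velocity (n := n) A (fun σ => c σ t) s) t) (unitTangent B (c s) t)
        + inner ℝ (riemannCurvature (n := n) (c s t) (velocity (n := n) A (fun σ => c σ t) s)
            (unitTangent B (c s) t) (unitTangent B (c s) t)) (N s t)) A s := by
  have uA := hA.uniqueDiffOn s hs
  have uB := hB.uniqueDiffOn t ht
  have mA := hc.mdifferentiableWithinAt_fst hs ht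
  have sT := hc.smoothField_unitTangent hA hB hi
  have sP := sT.covDerivT hc hA hB hi
  have sC := hc.smoothField_velocity_fst hA hB
  have sH := sC.covDerivT hc hA hB hi
  have hω := (hi.lineElement_pos hs ht).ne'
  have hα : ContDiffOn ℝ ∞ (fun z : ℝ × ℝ => -(inner ℝ (covDerivT (n := n) B (c z.1)
      (fun t => velocity (n := n) A (fun σ => c σ t) z.1) z.2) (unitTangent B (c z.1) z.2) : ℝ))
      (A ×ˢ B) := (sH.contDiffOn_inner hc sT).neg
  set α : ℝ → ℝ → ℝ := fun s t => inner ℝ (covDerivT (n := n) B (c s)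
      (fun t => velocity (n := n) A (fun σ => c σ t) s) t) (unitTangent B (c s) t) with hαdef
  have hαt : HasDerivWithinAt (fun τ => -α s τ) (derivWithin (fun τ => -α s τ) B t) B t :=
    (hasDerivWithinAt_slice_snd (f := fun z : ℝ × ℝ => -α z.1 z.2) (z := (s, t))
      ⟨univ, isOpen_univ, (inter_univ _).symm⟩ ⟨hs, ht⟩
      ((hα _ ⟨hs, ht⟩).differentiableWithinAt
        (by simp))).differentiableWithinAt.hasDerivWithinAt
  have hκ' : ∀ s ∈ A, ∀ t ∈ B,
      κ s t = inner ℝ (covDerivT B (c s) (unitTangent B (c s)) t) (N s t) := by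
    intro s hs t ht
    rw [hκ s hs t ht, real_inner_smul_left, hunit s hs t ht, mul_one]
  -- Since $|N|=1$. As $\nabla_TT$ is a multiple of $N$, this removes the term with $\nabla_sN$.
  have hNd : (inner ℝ (N s t) (covDeriv A (fun σ => c σ t) (fun σ => N σ t) s) : ℝ) = 0 := by
    have h1 := hasDerivWithinAt_inner uA mA (hN.diffFieldAt_fst hc hs ht)
      (hN.diffFieldAt_fst hc hs ht)
    have h2 := (hasDerivWithinAt_const s A (1 : ℝ)).congr (fun σ hσ => hunit σ hσ t ht)
      (hunit s hs t ht)
    have h3 := uA.eq_deriv _ h1 h2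
    rw [real_inner_comm] at h3
    linarith
  -- The full vector $\nabla_s\nabla_TT$. The derivative of $\alpha$ enters only as a multiple of
  -- $T$ and disappears on pairing with $N$.
  have hmain : covFst A c (fun s t => covDerivT B (c s) (unitTangent (n := n) B (c s)) t) s t =
      (-α s t) • covDerivT B (c s) (unitTangent B (c s)) t
      + (covDerivT (n := n) B (c s) (covDerivT B (c s)
          (fun t => velocity (n := n) A (fun σ => c σ t) s)) t
        + ((lineElement (n := n) B (c s) t)⁻¹ * derivWithin (fun τ => -α s τ) B t)
            • unitTangent B (c s) t
        + (-α s t) • covDerivT B (c s) (unitTangent B (c s)) t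
        + riemannCurvature (n := n) (c s t) (velocity (n := n) A (fun σ => c σ t) s)
            (unitTangent B (c s) t) (unitTangent B (c s) t)) := by
    have h1 : covFst A c (fun s t => covDerivT B (c s) (unitTangent (n := n) B (c s)) t) s t =
        (-α s t) • covDerivT B (c s) (unitTangent B (c s)) t
        + (lineElement (n := n) B (c s) t)⁻¹ • covFst A c (covSnd B c
          fun s t => unitTangent (n := n) B (c s) t) s t := by
      refine (covDeriv_smul (hasDerivWithinAt_inv_lineElement hc hA hB hi hs ht) uA
        ((sT.covSnd hc hA hB).diffFieldAt_fst hc hs ht)).trans ?_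
      rw [mul_smul]
      rfl
    have h2 := covFst_covSnd hc hA hB sT hs ht
    have h3 : covSnd B c (covFst A c fun s t => unitTangent (n := n) B (c s) t) s t =
        covDeriv B (c s) (fun t => covDerivT (n := n) B (c s)
            (fun t => velocity (n := n) A (fun σ => c σ t) s) t) t
          + (derivWithin (fun τ => -α s τ) B t • unitTangent B (c s) t
            + (-α s t) • covDeriv B (c s) (unitTangent B (c s)) t) := by
      have e1 := covDeriv_congr (γ := c s) (S := B) ht
        (fun τ hτ => covFst_unitTangent hc hA hB hi hs hτ)
      refine e1.trans ?_
      have dT := sT.diffFieldAt_snd hc hs ht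
      have dH := sH.diffFieldAt_snd hc hs ht
      rw [← covDeriv_smul hαt uB dT]
      exact covDeriv_add dH (DiffFieldAt.smul hαt.differentiableWithinAt dT)
    have k1 : (lineElement (n := n) B (c s) t)⁻¹ • covDeriv B (c s) (fun t => covDerivT (n := n) B
        (c s) (fun t => velocity (n := n) A (fun σ => c σ t) s) t) t = covDerivT (n := n) B (c s)
          (covDerivT B (c s) (fun t => velocity (n := n) A (fun σ => c σ t) s)) t := rfl
    have k2 : (lineElement (n := n) B (c s) t)⁻¹ • covDeriv B (c s) (unitTangent B (c s)) t =
        covDerivT B (c s) (unitTangent B (c s)) t := rfl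
    -- The factor $\omega$ in $\dot c=\omega T$ cancels against $\omega^{-1}$ and turns $R(c',\dot
    -- c)T$ into $R(c',T)T$.
    rw [h1, h2, h3, hi.velocity_eq hs ht, riemannCurvature_smul_right, smul_add, smul_add, smul_add,
      smul_comm _ (-α s t), k1, k2, smul_smul, smul_smul _ (lineElement (n := n) B (c s) t),
      inv_mul_cancel₀ hω, one_smul]
    abel
  have h1 := hasDerivWithinAt_inner uA mA (sP.diffFieldAt_fst hc hs ht)
    (hN.diffFieldAt_fst hc hs ht)
  have h2 := h1.congr (fun σ hσ => hκ' σ hσ t ht) (hκ' s hs t ht)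
  refine h2.congr_deriv ?_
  change inner ℝ (covFst A c (fun s t => covDerivT B (c s) (unitTangent (n := n) B (c s)) t) s t)
    (N s t) + _ = _
  have hTN : (inner ℝ (unitTangent (n := n) B (c s) t) (N s t) : ℝ) = 0 := by
    rw [real_inner_comm]
    exact hnormal s hs t ht
  rw [hmain, hκ s hs t ht]
  simp only [inner_add_left, real_inner_smul_left, hNd, hTN, hunit s hs t ht]
  ring

end FirstVariation

/-! ### Periodicity of fields along closed curves -/

section Periodicity

variable {n : ℕ} {M : Type*} [TopologicalSpace M] [ChartedSpace (EuclideanSpace ℝ (Fin n)) M]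
  [IsManifold (𝓡 n) ∞ M] {γ : ℝ → M} {P : ℝ}

/-- A vector field along a curve of period `P` has period `P`. -/
def PeriodicField (P : ℝ) (γ : ℝ → M) (V : ∀ t, TangentSpace (𝓡 n) (γ t)) : Prop :=
  ∀ t, (V (t + P) : EuclideanSpace ℝ (Fin n)) = V t

/-- Vectors at `γ (t + P)` and `γ t` have different types, so they are compared in the model space,
which underlies every tangent space. -/
theorem chartVec_congr (p : M) {x x' : M} (h : x = x') {v : TangentSpace (𝓡 n) x}
    {v' : TangentSpace (𝓡 n) x'} (hv : (v : EuclideanSpace ℝ (Fin n)) = v') :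
    chartVec p x v = chartVec p x' v' := by
  subst h
  exact congrArg (chartVec p x) hv

theorem velocity_eq_derivWithin {S : Set ℝ} {t : ℝ} (hS : UniqueDiffWithinAt ℝ S t)
    (hγ : MDifferentiableWithinAt 𝓘(ℝ, ℝ) (𝓡 n) γ S t) :
    (velocity S γ t : EuclideanSpace ℝ (Fin n)) =
      derivWithin (fun τ => extChartAt (𝓡 n) (γ t) (γ τ)) S t := by
  rw [(hasDerivWithinAt_extChartAt hγ (mem_chart_source _ _)).derivWithin hS]
  exact (chartVec_self _ _).symm

theorem derivWithin_univ_add_period {F : Type*} [NormedAddCommGroup F] [NormedSpace ℝ F]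
    {f : ℝ → F} (hf : ∀ t, f (t + P) = f t) (t : ℝ) :
    derivWithin f univ (t + P) = derivWithin f univ t := by
  rw [derivWithin_univ, ← deriv_comp_add_const]
  simp only [hf]

theorem periodicField_velocity (hP : ∀ t, γ (t + P) = γ t)
    (hγ : ∀ t, MDifferentiableWithinAt 𝓘(ℝ, ℝ) (𝓡 n) γ univ t) :
    PeriodicField (n := n) P γ (velocity univ γ) := by
  intro t
  rw [velocity_eq_derivWithin uniqueDiffWithinAt_univ (hγ _),
    velocity_eq_derivWithin uniqueDiffWithinAt_univ (hγ _), hP t]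
  exact derivWithin_univ_add_period (P := P) (f := fun τ => extChartAt (𝓡 n) (γ t) (γ τ))
    (fun τ => by rw [hP τ]) t

variable {V W : ∀ t, TangentSpace (𝓡 n) (γ t)}

theorem PeriodicField.smul {f : ℝ → ℝ} (hf : ∀ t, f (t + P) = f t) (hV : PeriodicField P γ V) :
    PeriodicField P γ (fun t => f t • V t) := by
  intro t
  change f (t + P) • (V (t + P) : EuclideanSpace ℝ (Fin n)) = f t • (V t : EuclideanSpace ℝ (Fin n))
  rw [hf]
  exact congrArg (f t • ·) (hV t)

variable [RiemannianBundle (fun x : M => TangentSpace (𝓡 n) x)]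

theorem PeriodicField.inner (hP : ∀ t, γ (t + P) = γ t) (hV : PeriodicField P γ V)
    (hW : PeriodicField P γ W) (t : ℝ) :
    (inner ℝ (V (t + P)) (W (t + P)) : ℝ) = inner ℝ (V t) (W t) := by
  have key : ∀ (x x' : M) (_ : x = x') (u v : TangentSpace (𝓡 n) x) (u' v' : TangentSpace (𝓡 n) x')
      (_ : (u : EuclideanSpace ℝ (Fin n)) = u') (_ : (v : EuclideanSpace ℝ (Fin n)) = v'),
      (Inner.inner ℝ u v : ℝ) = Inner.inner ℝ u' v' := by
    rintro x _ rfl u v u' v' hu hv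
    have hu' : u = u' := hu
    have hv' : v = v' := hv
    rw [hu', hv']
  exact key _ _ (hP t) _ _ _ _ (hV t) (hW t)

theorem lineElement_periodic (hP : ∀ t, γ (t + P) = γ t)
    (hγ : ∀ t, MDifferentiableWithinAt 𝓘(ℝ, ℝ) (𝓡 n) γ univ t) (t : ℝ) :
    lineElement (n := n) univ γ (t + P) = lineElement (n := n) univ γ t :=
  congrArg Real.sqrt ((periodicField_velocity hP hγ).inner hP (periodicField_velocity hP hγ) t)

theorem periodicField_unitTangent (hP : ∀ t, γ (t + P) = γ t)
    (hγ : ∀ t, MDifferentiableWithinAt 𝓘(ℝ, ℝ) (𝓡 n) γ univ t) :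
    PeriodicField (n := n) P γ (unitTangent univ γ) :=
  (periodicField_velocity hP hγ).smul fun t => by rw [lineElement_periodic hP hγ]

variable [IsContMDiffRiemannianBundle (𝓡 n) ∞ (EuclideanSpace ℝ (Fin n))
      (fun x : M => TangentSpace (𝓡 n) x)]

theorem PeriodicField.covDeriv (hP : ∀ t, γ (t + P) = γ t)
    (hγ : ∀ t, MDifferentiableWithinAt 𝓘(ℝ, ℝ) (𝓡 n) γ univ t) (hV : PeriodicField P γ V) :
    PeriodicField P γ (covDeriv univ γ V) := by
  intro t
  have h1 := chartVec_self (γ (t + P)) (CurveVariation.covDeriv univ γ V (t + P))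
  have h2 := chartVec_self (γ t) (CurveVariation.covDeriv univ γ V t)
  refine h1.symm.trans (Eq.trans ?_ h2)
  rw [chartVec_self_covDeriv, chartVec_self_covDeriv,
    chartVec_congr (γ (t + P)) (hP t) (hV t),
    chartVec_congr (γ (t + P)) (hP t) (periodicField_velocity hP hγ t), hP t,
    derivWithin_univ_add_period (P := P) (f := fun τ => chartVec (γ t) (γ τ) (V τ))
      fun τ => chartVec_congr (γ t) (hP τ) (hV τ)]

theorem PeriodicField.covDerivT (hP : ∀ t, γ (t + P) = γ t)
    (hγ : ∀ t, MDifferentiableWithinAt 𝓘(ℝ, ℝ) (𝓡 n) γ univ t) (hV : PeriodicField P γ V) :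
    PeriodicField P γ (covDerivT univ γ V) :=
  (hV.covDeriv hP hγ).smul fun t => by rw [lineElement_periodic hP hγ]

end Periodicity

/-! ### One-variable calculus on parameter intervals -/

section Calculus

variable {B : Set ℝ}

theorem ContDiffOn.hasDerivWithinAt_derivWithin {f : ℝ → ℝ} (hf : ContDiffOn ℝ ∞ f B) {t : ℝ}
    (ht : t ∈ B) : HasDerivWithinAt f (derivWithin f B t) B t :=
  ((hf t ht).differentiableWithinAt (by simp)).hasDerivWithinAt

theorem continuousOn_derivWithin (hB : IsParamInterval B) {f : ℝ → ℝ} (hf : ContDiffOn ℝ ∞ f B) :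
    ContinuousOn (fun t => derivWithin f B t) B :=
  hf.continuousOn_derivWithin hB.uniqueDiffOn (by simp)

theorem integral_derivWithin (hB : IsParamInterval B) {f : ℝ → ℝ} (hf : ContDiffOn ℝ ∞ f B)
    {L : ℝ} (hL : 0 ≤ L) (hLB : Icc 0 L ⊆ B) :
    ∫ t in (0 : ℝ)..L, derivWithin f B t = f L - f 0 := by
  refine intervalIntegral.integral_eq_sub_of_hasDerivAt_of_le hL (hf.continuousOn.mono hLB)
    (fun t ht => ?_) (ContinuousOn.intervalIntegrable ?_)
  · exact (ContDiffOn.hasDerivWithinAt_derivWithin hf (hLB (Ioo_subset_Icc_self ht))).hasDerivAt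
      (Filter.mem_of_superset (Icc_mem_nhds ht.1 ht.2) hLB)
  · rw [uIcc_of_le hL]
    exact (continuousOn_derivWithin hB hf).mono hLB

theorem derivWithin_eq_zero_iff_const (hB : IsParamInterval B) {f : ℝ → ℝ}
    (hf : ContDiffOn ℝ ∞ f B) :
    (∀ t ∈ B, derivWithin f B t = 0) ↔ ∃ k, ∀ t ∈ B, f t = k := by
  constructor
  · intro h
    obtain ⟨t₀, ht₀⟩ := hB.nonempty
    refine ⟨f t₀, fun t ht => ?_⟩
    refine hB.convex.is_const_of_fderivWithin_eq_zero (𝕜 := ℝ)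
      (fun τ hτ => (hf τ hτ).differentiableWithinAt (by simp)) (fun τ hτ => ?_) ht
      (interior_subset ht₀)
    ext
    exact h τ hτ
  · rintro ⟨k, hk⟩ t ht
    rw [derivWithin_congr hk (hk t ht), derivWithin_fun_const]
    rfl

/-- The derivative of `ρ ^ 2 * κ` vanishes if and only if `2 κ ρ' + ρ κ'` does. -/
theorem derivWithin_sq_mul_eq_zero_iff (hB : IsParamInterval B) {ρ κ : ℝ → ℝ}
    (hρ : ContDiffOn ℝ ∞ ρ B) (hκ : ContDiffOn ℝ ∞ κ B) :
    (∀ t ∈ B, derivWithin (fun τ => ρ τ ^ 2 * κ τ) B t = 0) ↔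
      ∀ t ∈ B, κ t * derivWithin ρ B t + derivWithin (fun τ => ρ τ * κ τ) B t = 0 := by
  have hm : ContDiffOn ℝ ∞ (fun τ => ρ τ * κ τ) B := hρ.mul hκ
  have hprod : ∀ t ∈ B, derivWithin (fun τ => ρ τ ^ 2 * κ τ) B t =
      ρ t * (κ t * derivWithin ρ B t + derivWithin (fun τ => ρ τ * κ τ) B t) := by
    intro t ht
    have e : (fun τ => ρ τ ^ 2 * κ τ) = fun τ => ρ τ * (ρ τ * κ τ) := by
      funext τ
      ring
    rw [e, ((ContDiffOn.hasDerivWithinAt_derivWithin hρ ht).fun_mul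
      (ContDiffOn.hasDerivWithinAt_derivWithin hm ht)).derivWithin (hB.uniqueDiffOn t ht)]
    ring
  constructor
  · intro h t ht
    -- If the factor multiplying `ρ` in `hprod` is nonzero at `t`, it is nonzero nearby within `B`
    -- by continuity. Then `ρ` vanishes nearby, and with it both derivatives at `t`, a
    -- contradiction.
    by_contra hne
    have hcont : ContinuousOn
        (fun t => κ t * derivWithin ρ B t + derivWithin (fun τ => ρ τ * κ τ) B t) B :=
      (hκ.continuousOn.mul (continuousOn_derivWithin hB hρ)).add (continuousOn_derivWithin hB hm)
    have hev : ∀ᶠ τ in nhdsWithin t B, ρ τ = 0 := by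
      filter_upwards [(hcont t ht).eventually_ne hne, self_mem_nhdsWithin] with τ hτ hτB
      have := h τ hτB
      rw [hprod τ hτB] at this
      exact (mul_eq_zero.1 this).resolve_right hτ
    have hρt : ρ t = 0 := hev.self_of_nhdsWithin ht
    have hd1 : derivWithin ρ B t = 0 := by
      have : derivWithin ρ B t = derivWithin (fun _ => (0 : ℝ)) B t :=
        Filter.EventuallyEq.derivWithin_eq hev hρt
      rw [this, derivWithin_fun_const]
      rfl
    have hd2 : derivWithin (fun τ => ρ τ * κ τ) B t = 0 := by
      have : derivWithin (fun τ => ρ τ * κ τ) B t = derivWithin (fun _ => (0 : ℝ)) B t :=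
        Filter.EventuallyEq.derivWithin_eq (hev.mono fun τ hτ => by simp [hτ]) (by simp [hρt])
      rw [this, derivWithin_fun_const]
      rfl
    exact hne (by rw [hd1, hd2]; ring)
  · intro h t ht
    rw [hprod t ht, h t ht, mul_zero]

end Calculus

/-! ### Parameter domains and the fundamental lemma -/

section Domain

theorem CurveDomain.isParamInterval (D : CurveDomain) : IsParamInterval D.carrier := by
  cases D
  · exact ⟨convex_univ, by simp [CurveDomain.carrier]⟩
  · exact ⟨convex_Icc 0 1, by simp [CurveDomain.carrier]⟩

theorem isParamInterval_Icc : IsParamInterval (Icc (0 : ℝ) 1) :=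
  ⟨convex_Icc 0 1, by simp⟩

theorem CurveDomain.period_pos (D : CurveDomain) : 0 < D.period := by
  cases D
  · exact Real.two_pi_pos
  · exact one_pos

theorem CurveDomain.Icc_subset_carrier (D : CurveDomain) : Icc 0 D.period ⊆ D.carrier := by
  cases D
  · exact subset_univ _
  · exact subset_rfl

/-- The fundamental lemma of the calculus of variations for vertical coefficients. -/
theorem eq_zero_of_integral_vertical_eq_zero {D : CurveDomain} {q l : ℝ → ℝ}
    (hq : ContDiffOn ℝ ∞ q D.carrier) (hl : ContDiffOn ℝ ∞ l D.carrier)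
    (hpos : ∀ t ∈ D.carrier, 0 < l t)
    (hper : D = .circle → ∀ t, q (t + 2 * Real.pi) = q t)
    (h : ∀ a, IsVerticalCoefficient D a → ∫ t in (0 : ℝ)..D.period, a t * l t * q t = 0) :
    ∀ t ∈ D.carrier, q t = 0 := by
  -- Testing with `a = w q` gives the integrand $w\,l\,q^2\ge0$, so $q$ vanishes where the weight is
  -- positive. The weight is 1 on the circle and $t(1-t)$ on the interval, where it makes `a` vanish
  -- at both ends.
  have key : ∀ w : ℝ → ℝ, ContDiffOn ℝ ∞ w D.carrier → (∀ t ∈ Icc 0 D.period, 0 ≤ w t) →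
      IsVerticalCoefficient D (fun t => w t * q t) →
      ∀ t ∈ Icc 0 D.period, 0 < w t → q t = 0 := by
    intro w hw hw0 ha t ht hwt
    by_contra hne
    have hI := h _ ha
    have hsub := D.Icc_subset_carrier
    refine absurd hI (ne_of_gt ?_)
    refine intervalIntegral.integral_pos D.period_pos
      ((((hw.mul hq).mul hl).mul hq).continuousOn.mono hsub) (fun x hx => ?_) ⟨t, ht, ?_⟩
    · have e : w x * q x * l x * q x = w x * l x * (q x * q x) := by ring
      have hx' := Ioc_subset_Icc_self hx
      rw [e]
      exact mul_nonneg (mul_nonneg (hw0 x hx') (hpos x (hsub hx')).le) (mul_self_nonneg _)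
    · have e : w t * q t * l t * q t = w t * l t * (q t * q t) := by ring
      rw [e]
      exact mul_pos (mul_pos hwt (hpos t (hsub ht))) (mul_self_pos.2 hne)
  cases D
  · intro t _
    have h1 : ∀ t ∈ Icc 0 (2 * Real.pi), q t = 0 := fun t ht =>
      key (fun _ => 1) contDiffOn_const (fun _ _ => zero_le_one)
        ⟨by simpa using hq, fun t => by simpa using hper rfl t⟩ t ht one_pos
    obtain ⟨y, hy, hty⟩ := Function.Periodic.exists_mem_Ico₀ (f := q) (hper rfl)
      Real.two_pi_pos t
    rw [hty]
    exact h1 y (Ico_subset_Icc_self hy)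
  · have h1 : EqOn q (fun _ => 0) (Ioo 0 1) := fun t ht =>
      key (fun t => t * (1 - t)) ((contDiff_id.mul (contDiff_const.sub contDiff_id)).contDiffOn)
        (fun t ht => mul_nonneg ht.1 (sub_nonneg.2 ht.2))
        ⟨((contDiff_id.mul (contDiff_const.sub contDiff_id)).contDiffOn).mul hq,
          by simp, by simp⟩ t (Ioo_subset_Icc_self ht) (mul_pos ht.1 (sub_pos.2 ht.2))
    -- The weight gives no information at the endpoints; continuity of `q` does.
    exact h1.of_subset_closure hq.continuousOn continuousOn_const Ioo_subset_Icc_self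
      (by rw [closure_Ioo zero_ne_one]; exact subset_rfl)

end Domain

/-! ### Normal paths and horizontality -/

section NormalPaths

variable {n : ℕ} {M : Type*} [TopologicalSpace M] [ChartedSpace (EuclideanSpace ℝ (Fin n)) M]
  [IsManifold (𝓡 n) ∞ M] [RiemannianBundle (fun x : M => TangentSpace (𝓡 n) x)]
  [IsContMDiffRiemannianBundle (𝓡 n) ∞ (EuclideanSpace ℝ (Fin n))
      (fun x : M => TangentSpace (𝓡 n) x)]
  {D : CurveDomain} {c : ℝ → ℝ → M} {N : ∀ s t, TangentSpace (𝓡 n) (c s t)} {κ ρ : ℝ → ℝ → ℝ}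

theorem contDiffOn_slice {A B : Set ℝ} {f : ℝ × ℝ → ℝ} (hf : ContDiffOn ℝ ∞ f (A ×ˢ B)) {s : ℝ}
    (hs : s ∈ A) : ContDiffOn ℝ ∞ (fun t => f (s, t)) B :=
  hf.comp (contDiff_const.prodMk contDiff_id).contDiffOn fun _ ht => ⟨hs, ht⟩

theorem IsCurvePath.smoothField_pathDeriv (hc : IsCurvePath n D c) :
    SmoothField (Icc 0 1) D.carrier c (fun s t => pathDeriv (n := n) c s t) :=
  SmoothSurface.smoothField_velocity_fst hc.smooth isParamInterval_Icc D.isParamInterval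

theorem IsNormalWithCurvature.curvature_eq_inner (hN : IsNormalWithCurvature D c N κ) {s t : ℝ}
    (hs : s ∈ Icc (0 : ℝ) 1) (ht : t ∈ D.carrier) :
    κ s t = inner ℝ (covDerivT D.carrier (c s) (unitTangent D.carrier (c s)) t) (N s t) := by
  rw [hN.curvature s hs t ht, real_inner_smul_left, hN.unit s hs t ht, mul_one]

theorem IsNormalWithCurvature.contDiffOn_curvature (hc : IsCurvePath n D c)
    (hN : IsNormalWithCurvature D c N κ) :
    ContDiffOn ℝ ∞ (fun z : ℝ × ℝ => κ z.1 z.2) (Icc 0 1 ×ˢ D.carrier) := by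
  have sT := SmoothSurface.smoothField_unitTangent (n := n) hc.smooth isParamInterval_Icc
    D.isParamInterval hc.immersed
  exact ((sT.covDerivT hc.smooth isParamInterval_Icc D.isParamInterval
    hc.immersed).contDiffOn_inner hc.smooth (SmoothField.of_contMDiffOn hN.smooth)).congr
    fun _ hz => hN.curvature_eq_inner hz.1 hz.2

theorem IsNormalWithCurvature.contDiffOn_speed (hc : IsCurvePath n D c)
    (hN : IsNormalWithCurvature D c N κ)
    (hρ : ∀ s ∈ Icc (0 : ℝ) 1, ∀ t ∈ D.carrier, ρ s t = inner ℝ (pathDeriv (n := n) c s t) (N s t)) :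
    ContDiffOn ℝ ∞ (fun z : ℝ × ℝ => ρ z.1 z.2) (Icc 0 1 ×ˢ D.carrier) :=
  (hc.smoothField_pathDeriv.contDiffOn_inner hc.smooth
    (SmoothField.of_contMDiffOn hN.smooth)).congr fun _ hz => hρ _ hz.1 _ hz.2

/-- The tangential part of the derivative of a normal variation. -/
theorem inner_covDerivT_pathDeriv_unitTangent (hc : IsCurvePath n D c)
    (hN : IsNormalWithCurvature D c N κ)
    (hρ : ∀ s ∈ Icc (0 : ℝ) 1, ∀ t ∈ D.carrier, ρ s t = inner ℝ (pathDeriv (n := n) c s t) (N s t))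
    (hnormal : ∀ s ∈ Icc (0 : ℝ) 1, ∀ t ∈ D.carrier, pathDeriv c s t = ρ s t • N s t)
    {s t : ℝ} (hs : s ∈ Icc (0 : ℝ) 1) (ht : t ∈ D.carrier) :
    (inner ℝ (covDerivT (n := n) D.carrier (c s) (pathDeriv c s) t)
      (unitTangent D.carrier (c s) t) : ℝ) = -(ρ s t) * κ s t := by
  have uB := D.isParamInterval.uniqueDiffOn t ht
  have sT := SmoothSurface.smoothField_unitTangent (n := n) hc.smooth isParamInterval_Icc
    D.isParamInterval hc.immersed
  have h0 : ∀ τ ∈ D.carrier,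
      (inner ℝ (pathDeriv (n := n) c s τ) (unitTangent D.carrier (c s) τ) : ℝ) = 0 := by
    intro τ hτ
    rw [hnormal s hs τ hτ, real_inner_smul_left, hN.normal s hs τ hτ, mul_zero]
  have h1 := hasDerivWithinAt_inner uB
    (SmoothSurface.mdifferentiableWithinAt_snd hc.smooth hs ht)
    (hc.smoothField_pathDeriv.diffFieldAt_snd hc.smooth hs ht)
    (sT.diffFieldAt_snd hc.smooth hs ht)
  have h2 := uB.eq_deriv _ h1 ((hasDerivWithinAt_const t D.carrier (0 : ℝ)).congr h0 (h0 t ht))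
  have h3 : (inner ℝ (pathDeriv (n := n) c s t)
      (covDerivT D.carrier (c s) (unitTangent D.carrier (c s)) t) : ℝ) = ρ s t * κ s t := by
    rw [hN.curvature s hs t ht, real_inner_smul_right, ← hρ s hs t ht, mul_comm]
  rw [covDerivT, real_inner_smul_right] at h3
  rw [covDerivT, real_inner_smul_left]
  linear_combination (lineElement (n := n) D.carrier (c s) t)⁻¹ * h2 - h3

/-- The derivative of the normal speed. -/
theorem hasDerivWithinAt_normalSpeed (hc : IsCurvePath n D c)
    (hN : IsNormalWithCurvature D c N κ)
    (hρ : ∀ s ∈ Icc (0 : ℝ) 1, ∀ t ∈ D.carrier, ρ s t = inner ℝ (pathDeriv (n := n) c s t) (N s t))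
    (hnormal : ∀ s ∈ Icc (0 : ℝ) 1, ∀ t ∈ D.carrier, pathDeriv c s t = ρ s t • N s t)
    {s t : ℝ} (hs : s ∈ Icc (0 : ℝ) 1) (ht : t ∈ D.carrier) :
    HasDerivWithinAt (ρ s) (lineElement (n := n) D.carrier (c s) t *
      inner ℝ (covDerivT (n := n) D.carrier (c s) (pathDeriv c s) t) (N s t)) D.carrier t := by
  have uB := D.isParamInterval.uniqueDiffOn t ht
  have mB := SmoothSurface.mdifferentiableWithinAt_snd hc.smooth hs ht
  have dN := (SmoothField.of_contMDiffOn hN.smooth).diffFieldAt_snd hc.smooth hs ht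
  have h1 := hasDerivWithinAt_inner uB mB
    (hc.smoothField_pathDeriv.diffFieldAt_snd hc.smooth hs ht) dN
  -- Since $|N|=1$, the derivative of $N$ along the curve is orthogonal to $N$; for $c'=\rho N$ the
  -- second term of the product rule vanishes.
  have h2 := uB.eq_deriv _ (hasDerivWithinAt_inner uB mB dN dN)
    ((hasDerivWithinAt_const t D.carrier (1 : ℝ)).congr (hN.unit s hs) (hN.unit s hs t ht))
  rw [real_inner_comm (N s t)] at h2
  have hne := (ImmersedCurves.lineElement_pos (n := n) hc.immersed hs ht).ne'
  refine (h1.congr (hρ s hs) (hρ s hs t ht)).congr_deriv ?_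
  rw [hnormal s hs t ht, covDerivT, real_inner_smul_left, real_inner_smul_left,
    mul_inv_cancel_left₀ hne]
  linear_combination (ρ s t / 2) * h2

/-- The integrand of the Sobolev product of a normal variation with a vertical field. -/
theorem sobolev_integrand_eq (hc : IsCurvePath n D c) (hN : IsNormalWithCurvature D c N κ)
    (hρ : ∀ s ∈ Icc (0 : ℝ) 1, ∀ t ∈ D.carrier, ρ s t = inner ℝ (pathDeriv (n := n) c s t) (N s t))
    (hnormal : ∀ s ∈ Icc (0 : ℝ) 1, ∀ t ∈ D.carrier, pathDeriv c s t = ρ s t • N s t)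
    {s t : ℝ} (hs : s ∈ Icc (0 : ℝ) 1) (ht : t ∈ D.carrier) {a : ℝ → ℝ}
    (ha : ContDiffOn ℝ ∞ a D.carrier) :
    (inner ℝ (pathDeriv (n := n) c s t) (a t • velocity D.carrier (c s) t)
      + inner ℝ (covDerivT D.carrier (c s) (fun t => pathDeriv (n := n) c s t) t)
        (covDerivT D.carrier (c s) (fun t => a t • velocity D.carrier (c s) t) t))
      * lineElement (n := n) D.carrier (c s) t =
    a t * lineElement (n := n) D.carrier (c s) t *
      (κ s t * derivWithin (ρ s) D.carrier t
        + derivWithin (fun τ => ρ s τ * κ s τ) D.carrier t)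
    - derivWithin (fun τ => a τ * lineElement (n := n) D.carrier (c s) τ * (ρ s τ * κ s τ))
        D.carrier t := by
  have hi : ImmersedCurves n (Icc 0 1) D.carrier c := hc.immersed
  have uB := D.isParamInterval.uniqueDiffOn t ht
  have sT := SmoothSurface.smoothField_unitTangent (n := n) hc.smooth isParamInterval_Icc
    D.isParamInterval hi
  have hl := contDiffOn_slice (SmoothSurface.contDiffOn_lineElement (n := n) hc.smooth
    isParamInterval_Icc D.isParamInterval hi) hs
  have hm := contDiffOn_slice ((hN.contDiffOn_speed hc hρ).mul (hN.contDiffOn_curvature hc)) hs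
  have hb : ContDiffOn ℝ ∞ (fun τ => a τ * lineElement (n := n) D.carrier (c s) τ) D.carrier :=
    ha.mul hl
  have db := ContDiffOn.hasDerivWithinAt_derivWithin hb ht
  have dm := ContDiffOn.hasDerivWithinAt_derivWithin hm ht
  have dρ := hasDerivWithinAt_normalSpeed hc hN hρ hnormal hs ht
  have hω := hi.lineElement_pos hs ht
  have e0 : (inner ℝ (pathDeriv (n := n) c s t) (velocity D.carrier (c s) t) : ℝ) = 0 := by
    rw [hi.velocity_eq hs ht, hnormal s hs t ht, real_inner_smul_left, real_inner_smul_right,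
      hN.normal s hs t ht, mul_zero, mul_zero]
  -- The vertical field is $bT$ with $b=a\omega$. Its derivative has components along $T$ and $N$
  -- only, so only these components of $\nabla_Tc'$ matter, in any dimension.
  have e1 : covDerivT D.carrier (c s) (fun t => a t • velocity (n := n) D.carrier (c s) t) t =
      ((lineElement (n := n) D.carrier (c s) t)⁻¹
        * derivWithin (fun τ => a τ * lineElement (n := n) D.carrier (c s) τ) D.carrier t)
          • unitTangent D.carrier (c s) t
      + (a t * lineElement (n := n) D.carrier (c s) t * κ s t) • N s t := by
    rw [covDerivT, covDeriv_congr (γ := c s) ht (W := fun τ =>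
      (a τ * lineElement (n := n) D.carrier (c s) τ) • unitTangent D.carrier (c s) τ)
      (fun τ hτ => by rw [hi.velocity_eq hs hτ, smul_smul]),
      covDeriv_smul db uB (sT.diffFieldAt_snd hc.smooth hs ht), smul_add, smul_smul,
      smul_comm, mul_smul _ (κ s t), ← hN.curvature s hs t ht]
    rfl
  rw [(db.fun_mul dm).derivWithin uB, dρ.derivWithin uB, e1, inner_add_right,
    real_inner_smul_right, real_inner_smul_right, real_inner_smul_right, e0]
  have e2 := inner_covDerivT_pathDeriv_unitTangent hc hN hρ hnormal hs ht
  change (_ + (_ * inner ℝ (covDerivT (n := n) D.carrier (c s) (pathDeriv c s) t)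
      (unitTangent D.carrier (c s) t) +
    _ * inner ℝ (covDerivT (n := n) D.carrier (c s) (pathDeriv c s) t) (N s t))) * _ = _
  rw [e2]
  field_simp
  ring

/-- After integration by parts the Sobolev product with $a\dot c$ is $\int a\,\omega\,q\,dt$ with no
boundary term, so the fundamental lemma applies to `q`. -/
theorem isHorizontal_iff (hc : IsCurvePath n D c) (hN : IsNormalWithCurvature D c N κ)
    (hρ : ∀ s ∈ Icc (0 : ℝ) 1, ∀ t ∈ D.carrier, ρ s t = inner ℝ (pathDeriv (n := n) c s t) (N s t))
    (hnormal : ∀ s ∈ Icc (0 : ℝ) 1, ∀ t ∈ D.carrier, pathDeriv c s t = ρ s t • N s t)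
    {s : ℝ} (hs : s ∈ Icc (0 : ℝ) 1) :
    IsHorizontal (n := n) D (c s) (fun t => pathDeriv c s t) ↔
      ∀ t ∈ D.carrier, derivWithin (fun τ => ρ s τ ^ 2 * κ s τ) D.carrier t = 0 := by
  have hi : ImmersedCurves n (Icc 0 1) D.carrier c := hc.immersed
  have hB := D.isParamInterval
  have hsub := D.Icc_subset_carrier
  have hl := contDiffOn_slice (SmoothSurface.contDiffOn_lineElement (n := n) hc.smooth
    isParamInterval_Icc hB hi) hs
  have hρs := contDiffOn_slice (hN.contDiffOn_speed hc hρ) hs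
  have hκs := contDiffOn_slice (hN.contDiffOn_curvature hc) hs
  have hm : ContDiffOn ℝ ∞ (fun τ => ρ s τ * κ s τ) D.carrier := hρs.mul hκs
  set q : ℝ → ℝ := fun t => κ s t * derivWithin (ρ s) D.carrier t
    + derivWithin (fun τ => ρ s τ * κ s τ) D.carrier t with hq
  have hqs : ContDiffOn ℝ ∞ q D.carrier :=
    (hκs.mul (hρs.derivWithin hB.uniqueDiffOn (m := ∞) le_rfl)).add
      (hm.derivWithin hB.uniqueDiffOn (m := ∞) le_rfl)
  rw [derivWithin_sq_mul_eq_zero_iff hB hρs hκs]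
  -- On the circle `N` is not assumed periodic (it may change sign after one turn), so `ρ` and `κ`
  -- need not be periodic separately. The combinations used are, because they can be written without
  -- `N`: $\rho\kappa=g(c',\nabla_TT)$ and $\kappa\rho_t=\omega\,g(\nabla_Tc',\nabla_TT)$.
  have hmper : D = .circle → (∀ t, ρ s (t + 2 * Real.pi) * κ s (t + 2 * Real.pi) =
      ρ s t * κ s t) ∧ (∀ t, q (t + 2 * Real.pi) = q t) ∧
      ∀ t, lineElement (n := n) D.carrier (c s) (t + 2 * Real.pi) =
        lineElement (n := n) D.carrier (c s) t := by
    rintro rfl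
    have hP := hc.periodic rfl s hs
    have hγ : ∀ t, MDifferentiableWithinAt 𝓘(ℝ, ℝ) (𝓡 n) (c s) univ t := fun t =>
      SmoothSurface.mdifferentiableWithinAt_snd hc.smooth hs (mem_univ t)
    have pC : PeriodicField (2 * Real.pi) (c s) (fun t => pathDeriv (n := n) c s t) := by
      intro t
      have uA := isParamInterval_Icc.uniqueDiffOn s hs
      refine (velocity_eq_derivWithin uA
        (SmoothSurface.mdifferentiableWithinAt_fst hc.smooth hs (mem_univ _))).trans
        (Eq.trans ?_ (velocity_eq_derivWithin uA
          (SmoothSurface.mdifferentiableWithinAt_fst hc.smooth hs (mem_univ _))).symm)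
      rw [hP t]
      exact derivWithin_congr (fun σ hσ => by rw [hc.periodic rfl σ hσ t]) (by rw [hP t])
    have pT := periodicField_unitTangent hP hγ
    have pK := pT.covDerivT hP hγ
    have pH := pC.covDerivT hP hγ
    have e1 : ∀ t, ρ s t * κ s t = inner ℝ (pathDeriv (n := n) c s t)
        (covDerivT univ (c s) (unitTangent univ (c s)) t) := by
      intro t
      have h := hN.curvature s hs t (mem_univ t)
      change covDerivT univ (c s) (unitTangent univ (c s)) t = _ at h
      rw [h, real_inner_smul_right, ← hρ s hs t (mem_univ t), mul_comm]
    have e2 : ∀ t, κ s t * derivWithin (ρ s) univ t = lineElement (n := n) univ (c s) t *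
        inner ℝ (covDerivT univ (c s) (fun t => pathDeriv (n := n) c s t) t)
          (covDerivT univ (c s) (unitTangent univ (c s)) t) := by
      intro t
      have h := hN.curvature s hs t (mem_univ t)
      have h2 := (hasDerivWithinAt_normalSpeed hc hN hρ hnormal hs (mem_univ t)).derivWithin
        uniqueDiffWithinAt_univ
      change covDerivT univ (c s) (unitTangent univ (c s)) t = _ at h
      change derivWithin (ρ s) univ t = lineElement (n := n) univ (c s) t *
        inner ℝ (covDerivT univ (c s) (fun t => pathDeriv (n := n) c s t) t) (N s t) at h2
      rw [h, h2, real_inner_smul_right]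
      ring
    have hmp : ∀ t, ρ s (t + 2 * Real.pi) * κ s (t + 2 * Real.pi) = ρ s t * κ s t := by
      intro t
      rw [e1, e1]
      exact pC.inner hP pK t
    refine ⟨hmp, fun t => ?_, lineElement_periodic hP hγ⟩
    change κ s _ * derivWithin (ρ s) univ _ + derivWithin (fun τ => ρ s τ * κ s τ) univ _ =
      κ s t * derivWithin (ρ s) univ t + derivWithin (fun τ => ρ s τ * κ s τ) univ t
    rw [e2, e2, derivWithin_univ_add_period hmp, lineElement_periodic hP hγ, pH.inner hP pK]
  have hint : ∀ a, IsVerticalCoefficient D a →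
      sobolevMetric D (c s) (fun t => pathDeriv (n := n) c s t)
        (fun t => a t • velocity D.carrier (c s) t) =
      ∫ t in (0 : ℝ)..D.period, a t * lineElement (n := n) D.carrier (c s) t * q t := by
    intro a ha
    have hf : ContDiffOn ℝ ∞ (fun τ => a τ * lineElement (n := n) D.carrier (c s) τ *
        (ρ s τ * κ s τ)) D.carrier := (ha.1.mul hl).mul hm
    have hcont1 : ContinuousOn (fun t => a t * lineElement (n := n) D.carrier (c s) t * q t)
      (uIcc 0 D.period) := by
      rw [uIcc_of_le D.period_pos.le]
      exact ((ha.1.mul hl).mul hqs).continuousOn.mono hsub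
    have hcont2 : ContinuousOn (fun t => derivWithin (fun τ => a τ *
        lineElement (n := n) D.carrier (c s) τ * (ρ s τ * κ s τ)) D.carrier t)
        (uIcc 0 D.period) := by
      rw [uIcc_of_le D.period_pos.le]
      exact (continuousOn_derivWithin hB hf).mono hsub
    -- The boundary values cancel by periodicity on the circle; on the interval both are zero
    -- because `a` vanishes at the ends.
    have hbd : a D.period * lineElement (n := n) D.carrier (c s) D.period *
          (ρ s D.period * κ s D.period) =
        a 0 * lineElement (n := n) D.carrier (c s) 0 * (ρ s 0 * κ s 0) := by
      cases D
      · obtain ⟨p1, -, p3⟩ := hmper rfl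
        have h1 := p1 0
        have h3 := p3 0
        have h4 := ha.2 0
        rw [zero_add] at h1 h3 h4
        simp only [CurveDomain.period]
        rw [h1, h3, h4]
      · simp only [CurveDomain.period]
        rw [ha.2.1, ha.2.2]
        ring
    rw [sobolevMetric, intervalIntegral.integral_congr (g := fun t =>
      a t * lineElement (n := n) D.carrier (c s) t * q t
      - derivWithin (fun τ => a τ * lineElement (n := n) D.carrier (c s) τ * (ρ s τ * κ s τ))
        D.carrier t), intervalIntegral.integral_sub hcont1.intervalIntegrable
        hcont2.intervalIntegrable, integral_derivWithin hB hf D.period_pos.le hsub, hbd, sub_self,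
        sub_zero]
    intro t ht
    rw [uIcc_of_le D.period_pos.le] at ht
    exact sobolev_integrand_eq hc hN hρ hnormal hs (hsub ht) ha.1
  constructor
  · intro h
    exact eq_zero_of_integral_vertical_eq_zero hqs hl (fun t ht => hi.lineElement_pos hs ht)
      (fun hD => (hmper hD).2.1) fun a ha => (hint a ha).symm.trans (h a ha)
  · intro h a ha
    rw [hint a ha, intervalIntegral.integral_congr (g := fun _ => (0 : ℝ)),
      intervalIntegral.integral_zero]
    intro t ht
    rw [uIcc_of_le D.period_pos.le] at ht
    change _ * q t = 0
    rw [show q t = 0 from h t (hsub ht), mul_zero]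

end NormalPaths

end CurveVariation

end

/-! ### The variation formulas and the horizontality criterion -/

theorem lemma1 (n : ℕ) (M : Type*) [TopologicalSpace M] [T2Space M] [SecondCountableTopology M]
    [ChartedSpace (EuclideanSpace ℝ (Fin n)) M] [IsManifold (𝓡 n) ∞ M]
    [RiemannianBundle (fun x : M => TangentSpace (𝓡 n) x)]
    [IsContMDiffRiemannianBundle (𝓡 n) ∞ (EuclideanSpace ℝ (Fin n))
      (fun x : M => TangentSpace (𝓡 n) x)]
    (D : CurveDomain) (c : ℝ → ℝ → M) (hc : IsCurvePath n D c) :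
    -- a) the variation of the line element
    (∀ s ∈ Icc (0 : ℝ) 1, ∀ t ∈ D.carrier,
      HasDerivWithinAt (fun σ => lineElement (n := n) D.carrier (c σ) t)
        (inner ℝ (covDerivT (n := n) D.carrier (c s) (pathDeriv c s) t)
            (unitTangent D.carrier (c s) t)
          * lineElement (n := n) D.carrier (c s) t) (Icc 0 1) s) ∧
    ∀ (N : ∀ s t, TangentSpace (𝓡 n) (c s t)) (κ : ℝ → ℝ → ℝ),
      IsNormalWithCurvature D c N κ →
      -- a) the variation of the curvature, in any dimension
      (∀ s ∈ Icc (0 : ℝ) 1, ∀ t ∈ D.carrier,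
        HasDerivWithinAt (fun σ => κ σ t)
          (inner ℝ (covDerivT (n := n) D.carrier (c s)
              (covDerivT D.carrier (c s) (pathDeriv c s)) t) (N s t)
            - 2 * κ s t * inner ℝ (covDerivT (n := n) D.carrier (c s) (pathDeriv c s) t)
              (unitTangent D.carrier (c s) t)
            + inner ℝ (riemannCurvature (n := n) (c s t) (pathDeriv c s t)
              (unitTangent D.carrier (c s) t) (unitTangent D.carrier (c s) t)) (N s t))
          (Icc 0 1) s) ∧
      -- a) the variation of the curvature, with the sectional curvature
      (∀ s ∈ Icc (0 : ℝ) 1, ∀ t ∈ D.carrier,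
        (n = 2 ∨
          pathDeriv c s t ∈ Submodule.span ℝ {unitTangent D.carrier (c s) t, N s t} ∨
          HasIsotropicCurvatureAt n (c s t)) →
        HasDerivWithinAt (fun σ => κ σ t)
          (inner ℝ (covDerivT (n := n) D.carrier (c s)
              (covDerivT D.carrier (c s) (pathDeriv c s)) t) (N s t)
            - 2 * κ s t * inner ℝ (covDerivT (n := n) D.carrier (c s) (pathDeriv c s) t)
              (unitTangent D.carrier (c s) t)
            + sectionalCurvature (n := n) (c s t) (N s t) (unitTangent D.carrier (c s) t)
              * inner ℝ (pathDeriv (n := n) c s t) (N s t))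
          (Icc 0 1) s) ∧
      -- b) normal paths
      ∀ ρ : ℝ → ℝ → ℝ,
        (∀ s ∈ Icc (0 : ℝ) 1, ∀ t ∈ D.carrier, ρ s t = inner ℝ (pathDeriv (n := n) c s t) (N s t)) →
        (∀ s ∈ Icc (0 : ℝ) 1, ∀ t ∈ D.carrier, pathDeriv c s t = ρ s t • N s t) →
        (∀ s ∈ Icc (0 : ℝ) 1, ∀ t ∈ D.carrier,
          HasDerivWithinAt (fun σ => lineElement (n := n) D.carrier (c σ) t)
            (-(ρ s t) * κ s t * lineElement (n := n) D.carrier (c s) t) (Icc 0 1) s) ∧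
        (IsHorizontalPath n D c ↔ ∀ s ∈ Icc (0 : ℝ) 1, ∀ t ∈ D.carrier,
          derivTheta n D.carrier (c s) (fun τ => ρ s τ ^ 2 * κ s τ) t = 0) ∧
        (IsHorizontalPath n D c ↔ ∀ s ∈ Icc (0 : ℝ) 1, ∃ k : ℝ, ∀ t ∈ D.carrier,
          ρ s t ^ 2 * κ s t = k) := by
  have hA := isParamInterval_Icc
  have hB := D.isParamInterval
  have hsm : SmoothSurface n (Icc 0 1) D.carrier c := hc.smooth
  have hi : ImmersedCurves n (Icc 0 1) D.carrier c := hc.immersed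
  have hline := fun (s : ℝ) (hs : s ∈ Icc (0 : ℝ) 1) (t : ℝ) (ht : t ∈ D.carrier) =>
    hasDerivWithinAt_lineElement hsm hA hB hi hs ht
  refine ⟨hline, fun N κ hN => ?_⟩
  have hcurv := fun (s : ℝ) (hs : s ∈ Icc (0 : ℝ) 1) (t : ℝ) (ht : t ∈ D.carrier) =>
    hasDerivWithinAt_curvature hsm hA hB hi (SmoothField.of_contMDiffOn hN.smooth) hN.unit
      hN.normal hN.curvature hs ht
  refine ⟨hcurv, fun s hs t ht h => ?_, fun ρ hρ hnormal => ?_⟩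
  · rw [← inner_riemannCurvature_eq_sectionalCurvature (c s t) (pathDeriv c s t) _ _
      (hi.inner_unitTangent hs ht) (hN.unit s hs t ht) (hN.normal s hs t ht) h]
    exact hcurv s hs t ht
  have hhor : IsHorizontalPath n D c ↔ ∀ s ∈ Icc (0 : ℝ) 1, ∀ t ∈ D.carrier,
      derivWithin (fun τ => ρ s τ ^ 2 * κ s τ) D.carrier t = 0 :=
    forall₂_congr fun _ hs => isHorizontal_iff hc hN hρ hnormal hs
  refine ⟨fun s hs t ht => ?_, ?_, ?_⟩
  · rw [← inner_covDerivT_pathDeriv_unitTangent hc hN hρ hnormal hs ht]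
    exact hline s hs t ht
  · rw [hhor]
    refine forall₂_congr fun s hs => forall₂_congr fun t ht => ?_
    -- The arc length derivative differs from the parameter derivative by the nonzero factor
    -- $\omega^{-1}$.
    rw [derivTheta, mul_eq_zero, or_iff_right (inv_ne_zero (hi.lineElement_pos hs ht).ne')]
  · rw [hhor]
    refine forall₂_congr fun s hs => derivWithin_eq_zero_iff_const hB ?_
    exact ((contDiffOn_slice (hN.contDiffOn_speed hc hρ) hs).pow 2).mul
      (contDiffOn_slice (hN.contDiffOn_curvature hc) hs)
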